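/- Let $U:\mathbb R\to[0,\infty)$ be continuously differentiable, let $\lambda_{\rm ref}>0$ and $0<\alpha<1$, and let $\mathcal Z=\mathbb R\times\mathbb R$. Assume that Hamilton's equations $\dot x=v,\ \dot v=-U'(x)$ have at most one solution $t\mapsto(x(t),v(t))$, $t\in\mathbb R$, for each initial state. Let $Z=\{Z_t:t\ge 0\}$ be the randomized Hamiltonian Monte Carlo (RHMC) process on $\mathcal Z$: it follows the Hamiltonian dynamics, and at the arrival times of an independent Poisson process of intensity $\lambda_{\rm ref}$ the velocity $v$ is replaced by $\alpha v+\sqrt{1-\alpha^2}\,\xi$ with a fresh independent standard Gaussian $\xi$. Let $P^tf(z)=\mathbb E^z[f(Z_t)]$. (1) The Hamiltonian dynamics is defined for all times, and $Z$ is a Feller process: it is a Markov process with transition semigroup $(P^t)_{t\ge0}$, for every initial law; $P^t$ maps $C_0(\mathcal Z)$ into itself for every $t\ge0$; and $\|P^tf-f\|_\infty\to0$ as $t\downarrow0$ for every $f\in C_0(\mathcal Z)$. Moreover each $f\in C_c^\infty(\mathcal Z)$ belongs to the domain of its generator $\mathcal A$ on $C_0(\mathcal Z)$, and $$\mathcal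 Af(x,v)=\partial_xf(x,v)\,v-\partial_vf(x,v)\,U'(x)+\lambda_{\rm ref}\,[Q_\alpha f(x,v)-f(x,v)],$$ $$Q_\alpha f(x,v)=\frac1{\sqrt{2\pi}}\int_{\mathbb R}e^{-\xi^2/2}f\big(x,\alpha v+\sqrt{1-\alpha^2}\,\xi\big)\,d\xi .$$ (2) If in addition $U\in C^\infty(\mathbb R)$ and $\sup_x|U''(x)|<\infty$ (in which case the uniqueness assumption need not be made, since it holds automatically), then, besides the assertions of (1), $C_c^\infty(\mathcal Z)$ is a core for $\mathcal A$: it is dense in the domain of $\mathcal A$ for the norm $\|f\|_\infty+\|\mathcal Af\|_\infty$. -/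

import Mathlib

open MeasureTheory ProbabilityTheory Filter Topology
open scoped ZeroAtInfty ContDiff

noncomputable section

/-- The phase space of positions and velocities `(x, v)`, in dimension one. -/
abbrev Phase : Type := ℝ × ℝ

/-! ### Hamiltonian dynamics -/

/-- `γ` solves Hamilton's equations `x' = v`, `v' = -U'(x)` on the whole time axis. -/
def IsHamiltonianPath (U : ℝ → ℝ) (γ : ℝ → Phase) : Prop :=
  ∀ t : ℝ, HasDerivAt γ ((γ t).2, -deriv U (γ t).1) t

/-- Hamilton's equations have at most one solution through each initial state. -/
def HamiltonianUniqueness (U : ℝ → ℝ) : Prop :=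
  ∀ γ₁ γ₂ : ℝ → Phase, IsHamiltonianPath U γ₁ → IsHamiltonianPath U γ₂ → γ₁ 0 = γ₂ 0 → γ₁ = γ₂

/-- The state at time `t` of the solution of Hamilton's equations started from `z`
(an arbitrary value if there is no solution, some solution if there are several). -/
def hamiltonianFlow (U : ℝ → ℝ) (t : ℝ) (z : Phase) : Phase :=
  Classical.epsilon (fun γ : ℝ → Phase => IsHamiltonianPath U γ ∧ γ 0 = z) t

/-! ### The RHMC process -/

/-- Law of the driving noise: independent pairs `(τₙ, ξₙ)`, where the waiting time `τₙ` is
exponential of rate `lam`, `ξₙ` is standard Gaussian, and `τₙ`, `ξₙ` are independent. -/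
def noiseLaw (lam : ℝ) : Measure (ℕ → ℝ × ℝ) :=
  Measure.infinitePi (fun _ : ℕ => (expMeasure lam).prod (gaussianReal 0 1))

/-- Time of the `n`-th refreshment, `Tₙ = τ₀ + ⋯ + τₙ₋₁` (so `T₀ = 0`): the arrival times of a
Poisson process when the waiting times are exponential. -/
def refreshTime (w : ℕ → ℝ × ℝ) (n : ℕ) : ℝ := ∑ i ∈ Finset.range n, (w i).1

/-- Number of refreshments up to and including time `t`, that is the number of `n ≥ 1` with
`Tₙ ≤ t`. -/
def refreshCount (w : ℕ → ℝ × ℝ) (t : ℝ) : ℕ := Set.ncard {n : ℕ | refreshTime w (n + 1) ≤ t}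

/-- Auto-regressive refreshment of the velocity by `ξ`. -/
def refresh (α : ℝ) (z : Phase) (ξ : ℝ) : Phase := (z.1, α * z.2 + √(1 - α ^ 2) * ξ)

/-- State just after the `n`-th refreshment, for the process started from `z`. -/
def refreshState (U : ℝ → ℝ) (α : ℝ) (w : ℕ → ℝ × ℝ) (z : Phase) : ℕ → Phase
  | 0 => z
  | n + 1 => refresh α (hamiltonianFlow U (w n).1 (refreshState U α w z n)) (w n).2

/-- The RHMC process at time `t`, started from `z`: Hamiltonian dynamics, with the velocity
refreshed at the times `T₁, T₂, …`. -/
def rhmc (U : ℝ → ℝ) (α : ℝ) (t : ℝ) (w : ℕ → ℝ × ℝ) (z : Phase) : Phase :=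
  hamiltonianFlow U (t - refreshTime w (refreshCount w t))
    (refreshState U α w z (refreshCount w t))

/-! ### Markov and Feller processes, generators, cores -/

/-- The σ-algebra generated by the process up to time `s`. -/
abbrev pastSigma {Ω : Type*} (Z : ℝ → Ω → Phase) (s : ℝ) : MeasurableSpace Ω :=
  ⨆ u ∈ Set.Icc (0 : ℝ) s, MeasurableSpace.comap (Z u) inferInstance

/-- `Z` is a Markov process (with respect to its own filtration), with transition operators
`P t`, acting on bounded Borel functions. -/
structure IsMarkovProcess {Ω : Type*} [MeasurableSpace Ω] (μ : Measure Ω) (Z : ℝ → Ω → Phase)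
    (P : ℝ → (Phase → ℝ) → Phase → ℝ) : Prop where
  measurable : ∀ t : ℝ, 0 ≤ t → Measurable (Z t)
  markov : ∀ s t : ℝ, 0 ≤ s → 0 ≤ t → ∀ f : Phase → ℝ, Measurable f → (∃ C, ∀ z, |f z| ≤ C) →
    μ[fun w => f (Z (s + t) w) | pastSigma Z s] =ᵐ[μ] fun w => P t f (Z s w)

/-- `Pᵗ f(z) = 𝔼[f(Zₜᶻ)]`, where `Z t w z` is the process started from `z`. -/
def transition {Ω : Type*} [MeasurableSpace Ω] (μ : Measure Ω) (Z : ℝ → Ω → Phase → Phase)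
    (t : ℝ) (f : Phase → ℝ) (z : Phase) : ℝ :=
  ∫ w, f (Z t w z) ∂μ

/-- Feller process: a Markov process, for every law `ν` of the starting point (chosen
independently of the noise), whose transition operators preserve `C₀` and are strongly
continuous on it. -/
structure IsFellerProcess {Ω : Type*} [MeasurableSpace Ω] (μ : Measure Ω)
    (Z : ℝ → Ω → Phase → Phase) : Prop where
  start : ∀ z : Phase, ∀ᵐ w ∂μ, Z 0 w z = z
  markov : ∀ ν : Measure Phase, IsProbabilityMeasure ν →
    IsMarkovProcess (ν.prod μ) (fun t p => Z t p.2 p.1) (transition μ Z)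
  feller : ∀ t : ℝ, 0 ≤ t → ∀ f : C₀(Phase, ℝ), ∃ g : C₀(Phase, ℝ),
    ∀ z, g z = transition μ Z t f z
  strongly_continuous : ∀ f : C₀(Phase, ℝ),
    TendstoUniformly (fun t => transition μ Z t f) f (𝓝[≥] (0 : ℝ))

/-- `f` is in the domain of the generator of `P` on `C₀`, and the generator maps it to `g`: the
difference quotients `(Pᵗ f - f) / t` converge uniformly to `g` as `t ↓ 0`. -/
def HasGenerator (P : ℝ → (Phase → ℝ) → Phase → ℝ) (f g : C₀(Phase, ℝ)) : Prop :=
  TendstoUniformly (fun t z => (P t f z - f z) / t) g (𝓝[>] (0 : ℝ))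

/-- The set `D` is a core for the generator of `P`: it is contained in the domain, and dense in
the domain for the graph norm `‖f‖∞ + ‖𝓐 f‖∞`. -/
def IsCore (P : ℝ → (Phase → ℝ) → Phase → ℝ) (D : Set C₀(Phase, ℝ)) : Prop :=
  (∀ f ∈ D, ∃ g, HasGenerator P f g) ∧
    ∀ f g, HasGenerator P f g → ∀ ε > 0,
      ∃ f' ∈ D, ∃ g', HasGenerator P f' g' ∧ ‖f' - f‖ + ‖g' - g‖ < ε

/-- The space of smooth compactly supported functions, as a subset of `C₀`. -/
def smoothCompact : Set C₀(Phase, ℝ) :=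
  {f | ContDiff ℝ ∞ (f : Phase → ℝ) ∧ HasCompactSupport (f : Phase → ℝ)}

/-- The refreshment operator
`Q_α f(x,v) = (2π)^(-1/2) ∫ exp(-ξ²/2) f(x, α v + √(1-α²) ξ) dξ`. -/
def refreshOp (α : ℝ) (f : Phase → ℝ) (z : Phase) : ℝ :=
  (√(2 * Real.pi))⁻¹ *
    ∫ ξ : ℝ, Real.exp (-ξ ^ 2 / 2) * f (z.1, α * z.2 + √(1 - α ^ 2) * ξ)

/-- The expression
`𝓐 f(x,v) = ∂ₓf(x,v) v - ∂ᵥf(x,v) U'(x) + lam (Q_α f(x,v) - f(x,v))`. -/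
def rhmcGenerator (U : ℝ → ℝ) (lam α : ℝ) (f : Phase → ℝ) (z : Phase) : ℝ :=
  deriv (fun x => f (x, z.2)) z.1 * z.2 - deriv (fun v => f (z.1, v)) z.2 * deriv U z.1
    + lam * (refreshOp α f z - f z)

/-- The RHMC process is a Feller process (its Hamiltonian flow being well defined), whose
generator is given on smooth compactly supported functions by `rhmcGenerator`. -/
structure RHMCIsFeller (U : ℝ → ℝ) (lam α : ℝ) : Prop where
  flow : ∀ z, IsHamiltonianPath U (fun t => hamiltonianFlow U t z) ∧ hamiltonianFlow U 0 z = z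
  feller : IsFellerProcess (noiseLaw lam) (rhmc U α)
  generator : ∀ f ∈ smoothCompact, ∃ g : C₀(Phase, ℝ),
    (∀ z, g z = rhmcGenerator U lam α f z) ∧
      HasGenerator (transition (noiseLaw lam) (rhmc U α)) f g

end

/-! The energy v² + 2U(x) is conserved and U ≥ 0, so the initial energy bounds the velocity: on
bounded time intervals solutions stay in compact sets and cannot explode. Existence follows by
approximating U with potentials having bounded Lipschitz derivatives and passing to the limit along
an ultrafilter (`exists_limit_hamiltonianPath`). The same compactness, together with uniqueness,
makes the flow φ continuous.

The Markov property is the lack of memory of the exponential law, expressed by a coupling. Following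
a noise up to time s and an independent noise afterwards (`splice`) again yields a sequence with the
law of the noise (`measurePreserving_splice`). The process driven by it has the old past and, after
s, is a fresh process started from its state at s (`rhmc_splice`). The space C₀ is preserved path by
path: for fixed noise the state at time t is a homeomorphic function of the starting point, since α
≠ 0, and averages of such compositions stay in C₀.

Conditioning on the first refreshment gives Pᵗf = e^(-λt) f∘φ_t + (1 - e^(-λt)) Q_α f + o(t),
uniformly. Hence the generator of the process is that of the flow plus the bounded operator λ(Q_α -
1), with the same domain (`hasGenerator_rhmc_iff`).

The core statement thus concerns the flow alone. Let A be its generator. For f smooth with compact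
support, the truncated resolvent u = ∫₀ᵀ e^(-t) f∘φ_t dt is Lipschitz with compact support and (1 -
A)u = f - e^(-T) f∘φ_T (`exists_approx_resolvent`). Convolution replaces u by smooth functions with
nearby images under A, by a commutator estimate (`exists_smooth_approx`). So 1 - A maps the smooth
compactly supported functions onto a dense subspace, and dissipativity
(`HasGenerator.norm_le_norm_sub`) turns this into density for the graph norm. -/

/-! ### Compactness of solutions of differential equations. -/

section FlowLimits

variable {E : Type*} [NormedAddCommGroup E] [NormedSpace ℝ E]

/-- Pointwise limits along an ultrafilter of solutions of approximating equations exist, and solve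
the limiting equation. -/
theorem exists_limit_trajectory [ProperSpace E] {ι : Type*} (l : Ultrafilter ι) {b : E → E}
    (hb : Continuous b) {B : ι → E → E}
    (hB : ∀ R ε : ℝ, 0 < ε → ∀ᶠ i in (l : Filter ι), ∀ y, ‖y‖ ≤ R → ‖B i y - b y‖ ≤ ε)
    {γ : ι → ℝ → E}
    (hγ : ∀ T : ℝ, ∃ K : ℝ, ∀ᶠ i in (l : Filter ι), ∀ s, |s| < T →
      HasDerivAt (γ i) (B i (γ i s)) s ∧ ‖B i (γ i s)‖ ≤ K)
    {z : E} (h0 : Tendsto (fun i => γ i 0) l (𝓝 z)) :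
    ∃ γ' : ℝ → E, (∀ t, HasDerivAt γ' (b (γ' t)) t) ∧ γ' 0 = z ∧
      ∀ t, Tendsto (fun i => γ i t) l (𝓝 (γ' t)) := by
  have lip : ∀ (i : ι) (T K : ℝ), (∀ s, |s| < T →
      HasDerivAt (γ i) (B i (γ i s)) s ∧ ‖B i (γ i s)‖ ≤ K) → ∀ s t, |s| < T → |t| < T →
      ‖γ i t - γ i s‖ ≤ K * |t - s| := by
    intro i T K h s t hs ht
    refine (convex_ball (0 : ℝ) T).norm_image_sub_le_of_norm_hasDerivWithin_le
      (f' := fun s => B i (γ i s)) (fun x hx => (h x ?_).1.hasDerivWithinAt)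
      (fun x hx => (h x ?_).2) ?_ ?_ <;> simp_all
  have key : ∀ t, ∃ y, Tendsto (fun i => γ i t) l (𝓝 y) := by
    intro t
    obtain ⟨K, hK⟩ := hγ (|t| + 1)
    have : ∀ᶠ i in (l : Filter ι), γ i t ∈ Metric.closedBall z (K * |t| + 1) := by
      filter_upwards [hK, h0 (Metric.ball_mem_nhds z one_pos)] with i hi h1
      have h2 := lip i _ K hi 0 t (by simp; positivity) (by simp)
      have h3 : ‖γ i 0 - z‖ < 1 := by simpa [dist_eq_norm] using h1
      rw [Metric.mem_closedBall, dist_eq_norm, ← sub_add_sub_cancel _ (γ i 0)]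
      refine (norm_add_le _ _).trans ?_
      simp only [sub_zero] at h2
      linarith
    -- An ultrafilter converges on every compact set, so the same one serves all times at once and
    -- no diagonal subsequence is needed.
    obtain ⟨y, -, hy⟩ := (isCompact_closedBall z (K * |t| + 1)).ultrafilter_le_nhds
      (l.map fun i => γ i t) (le_principal_iff.2 this)
    exact ⟨y, hy⟩
  choose γ' hγ' using key
  refine ⟨γ', fun t => ?_, tendsto_nhds_unique (hγ' 0) h0, hγ'⟩
  rw [hasDerivAt_iff_isLittleO, Asymptotics.isLittleO_iff]
  intro ε hε
  obtain ⟨δ, hδ, hδb⟩ := Metric.continuousAt_iff.1 (hb.continuousAt (x := γ' t)) (ε / 2) (by positivity)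
  obtain ⟨K, hK⟩ := hγ (|t| + 1)
  set K' := max K 1 with hK'
  have hK1 : 0 < K' := lt_of_lt_of_le one_pos (le_max_right _ _)
  -- Over a time δ / (2K') an approximating path moves by at most δ/2; convergence at time t
  -- accounts for the other δ/2.
  filter_upwards [Metric.ball_mem_nhds t (show 0 < min 1 (δ / (2 * K')) by positivity)] with s hs
  rw [Metric.mem_ball, lt_min_iff] at hs
  have lim : Tendsto (fun i => ‖γ i s - γ i t - (s - t) • b (γ' t)‖) l
      (𝓝 ‖γ' s - γ' t - (s - t) • b (γ' t)‖) :=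
    (((hγ' s).sub (hγ' t)).sub_const _).norm
  refine le_of_tendsto lim ?_
  filter_upwards [hK, hB (‖γ' t‖ + δ) (ε / 2) (by positivity),
    hγ' t (Metric.ball_mem_nhds _ (half_pos hδ))] with i hi hi2 hi3
  have hT : ∀ r ∈ Metric.ball t (min 1 (δ / (2 * K'))), |r| < |t| + 1 := by
    intro r hr
    have : |r - t| < 1 := (lt_min_iff.1 (Metric.mem_ball.1 hr)).1
    have := abs_sub_abs_le_abs_sub r t
    linarith
  have near : ∀ r ∈ Metric.ball t (min 1 (δ / (2 * K'))), dist (γ i r) (γ' t) < δ := by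
    intro r hr
    have h1 := lip i _ K hi t r (by linarith) (hT r hr)
    have h2 : |r - t| < δ / (2 * K') := (lt_min_iff.1 (Metric.mem_ball.1 hr)).2
    have h3 : K * |r - t| ≤ δ / 2 := by
      calc K * |r - t| ≤ K' * (δ / (2 * K')) := by gcongr; exact le_max_left _ _
        _ = δ / 2 := by field_simp
    have h4 : dist (γ i t) (γ' t) < δ / 2 := hi3
    have h5 := dist_triangle (γ i r) (γ i t) (γ' t)
    rw [dist_eq_norm (γ i r) (γ i t)] at h5
    linarith
  -- Subtracting the linear motion leaves a path of speed at most ε, a bound that survives the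
  -- limit. It gives differentiability of the limit without integral equations.
  have := (convex_ball t (min 1 (δ / (2 * K')))).norm_image_sub_le_of_norm_hasDerivWithin_le
    (f := fun r => γ i r - r • b (γ' t)) (f' := fun r => B i (γ i r) - b (γ' t)) (C := ε)
    (x := t) (y := s) (fun r hr => ?_) (fun r hr => ?_) (Metric.mem_ball_self (by positivity))
    (by simpa [Metric.mem_ball, lt_min_iff] using hs)
  · refine le_trans (le_of_eq ?_) this
    congr 1
    module
  · have := ((hi r (hT r hr)).1.sub ((hasDerivAt_id r).smul_const (b (γ' t)))).hasDerivWithinAt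
      (s := Metric.ball t (min 1 (δ / (2 * K'))))
    simpa only [one_smul] using! this
  · have h1 := near r hr
    have h2 : ‖γ i r‖ ≤ ‖γ' t‖ + δ := by
      have := norm_sub_norm_le (γ i r) (γ' t)
      rw [dist_eq_norm] at h1
      linarith
    have h3 := hi2 _ h2
    have h4 := hδb h1
    rw [dist_eq_norm] at h4
    calc ‖B i (γ i r) - b (γ' t)‖ = ‖(B i (γ i r) - b (γ i r)) + (b (γ i r) - b (γ' t))‖ := by
          congr 1; abel
      _ ≤ ε := (norm_add_le _ _).trans (by linarith)

end FlowLimits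

/-! ### Energy bounds and existence of Hamiltonian trajectories. -/

section Hamiltonian

theorem hasDerivAt_components {γ : ℝ → Phase} {t a b : ℝ} (h : HasDerivAt γ (a, b) t) :
    HasDerivAt (fun s => (γ s).1) a t ∧ HasDerivAt (fun s => (γ s).2) b t :=
  ⟨by simpa using h.hasFDerivAt.fst.hasDerivAt, by simpa using h.hasFDerivAt.snd.hasDerivAt⟩

/-- Conservation of energy, for a solution of Hamilton's equations on a time interval. -/
theorem energy_conservation {U : ℝ → ℝ} (hU : Differentiable ℝ U) {γ : ℝ → Phase} {T : ℝ}
    (h : ∀ s, |s| < T → HasDerivAt γ ((γ s).2, -deriv U (γ s).1) s) {s : ℝ} (hs : |s| < T) :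
    (γ s).2 ^ 2 + 2 * U (γ s).1 = (γ 0).2 ^ 2 + 2 * U (γ 0).1 := by
  have hd : ∀ r, |r| < T → HasDerivAt (fun r => (γ r).2 ^ 2 + 2 * U (γ r).1) 0 r := by
    intro r hr
    obtain ⟨h1, h2⟩ := hasDerivAt_components (h r hr)
    refine ((h2.pow 2).add (((hU _).hasDerivAt.comp r h1).const_mul 2)).congr_deriv ?_
    push_cast
    ring
  have := (convex_ball (0 : ℝ) T).norm_image_sub_le_of_norm_hasDerivWithin_le
    (f := fun r => (γ r).2 ^ 2 + 2 * U (γ r).1) (f' := fun _ => 0) (C := 0) (x := 0) (y := s)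
    (fun r hr => (hd r (by simpa using hr)).hasDerivWithinAt) (by simp)
    (by simpa using (abs_nonneg s).trans_lt hs) (by simpa using hs)
  have h0 := norm_le_zero_iff.1 (this.trans (by simp))
  linarith

theorem abs_velocity_le {U : ℝ → ℝ} (hU : Differentiable ℝ U) (hU0 : ∀ x, 0 ≤ U x)
    {γ : ℝ → Phase} {T : ℝ}
    (h : ∀ s, |s| < T → HasDerivAt γ ((γ s).2, -deriv U (γ s).1) s) {s : ℝ} (hs : |s| < T) :
    |(γ s).2| ≤ √((γ 0).2 ^ 2 + 2 * U (γ 0).1) := by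
  rw [← Real.sqrt_sq_eq_abs]
  refine Real.sqrt_le_sqrt ?_
  have := energy_conservation hU h hs
  have := hU0 (γ s).1
  linarith

/-- Clamping the velocity at V makes the field bounded, so Picard–Lindelöf reaches the whole
interval in one step. Since |F| ≤ M, the velocity of the solution never exceeds |z.2| + M T = V, so
the clamp is inactive. -/
theorem exists_trajectory_of_lipschitzWith {F : ℝ → ℝ} {K : NNReal} (hF : LipschitzWith K F)
    {M : ℝ} (hM : ∀ x, |F x| ≤ M) {T : ℝ} (hT : 0 < T) (z : Phase) :
    ∃ γ : ℝ → Phase, γ 0 = z ∧ ∀ s, |s| < T → HasDerivAt γ ((γ s).2, F (γ s).1) s := by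
  have hM0 : 0 ≤ M := (abs_nonneg _).trans (hM 0)
  set V : ℝ := |z.2| + M * T with hV
  have hV0 : 0 ≤ V := by positivity
  set f : Phase → Phase := fun y => (max (-V) (min V y.2), F y.1) with hf
  have hclamp : ∀ v, |max (-V) (min V v)| ≤ V := fun v => abs_le.2
    ⟨le_max_left _ _, max_le (by linarith) (min_le_left _ _)⟩
  have hlip : LipschitzWith (max 1 K) f := by
    refine LipschitzWith.prodMk ?_ (by simpa [Function.comp_def] using hF.comp LipschitzWith.prod_fst)
    exact ((LipschitzWith.prod_snd.const_min V).const_max (-V))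
  have hbd : ∀ y, ‖f y‖ ≤ max V M := fun y => by
    rw [Prod.norm_def]
    exact max_le_max (hclamp _) (hM _)
  set L : NNReal := ⟨max V M, le_max_of_le_left hV0⟩ with hL
  have hPL : IsPicardLindelof (fun _ => f) (tmin := -T) (tmax := T) ⟨0, by simp [hT.le]⟩ z
      (L * ⟨T, hT.le⟩) 0 L (max 1 K) :=
    { lipschitzOnWith := fun t _ => hlip.lipschitzOnWith
      continuousOn := fun _ _ => continuousOn_const
      norm_le := fun t _ x _ => hbd x
      mul_max_le := by simp only [sub_zero, zero_sub, neg_neg, max_self, NNReal.coe_zero]; rfl }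
  obtain ⟨γ, h0, hγ⟩ := hPL.exists_eq_forall_mem_Icc_hasDerivWithinAt₀
  have h1 : ∀ s, |s| < T → HasDerivAt γ (f (γ s)) s := by
    intro s hs
    rw [abs_lt] at hs
    exact (hγ s ⟨hs.1.le, hs.2.le⟩).hasDerivAt (Icc_mem_nhds hs.1 hs.2)
  refine ⟨γ, h0, fun s hs => ?_⟩
  have h2 : ‖(γ s).2 - (γ 0).2‖ ≤ M * ‖s - 0‖ := by
    refine (convex_ball (0 : ℝ) T).norm_image_sub_le_of_norm_hasDerivWithin_le
      (f := fun r => (γ r).2) (f' := fun r => F (γ r).1)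
      (fun r hr => (hasDerivAt_components (h1 r (by simpa using hr))).2.hasDerivWithinAt)
      (fun r _ => hM _) (by simpa using hT) (by simpa using hs)
  have h3 : |(γ s).2| ≤ V := by
    rw [show γ 0 = z from h0] at h2
    have := norm_sub_norm_le (γ s).2 z.2
    have : M * |s| ≤ M * T := by gcongr
    simp only [Real.norm_eq_abs, sub_zero] at *
    linarith
  have h4 : max (-V) (min V (γ s).2) = (γ s).2 := by
    rw [abs_le] at h3
    rw [min_eq_right h3.2, max_eq_right h3.1]
  have := h1 s hs
  simpa only [hf, h4] using this

/-- `V n` is the average over [x, x + 1/(n+1)] of U with its argument truncated to [-n, n]. Its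
derivative is a difference quotient, hence bounded and Lipschitz, and is close to U' on compact sets
by the mean value theorem. The last bound controls the initial energies uniformly in n. -/
theorem exists_lipschitz_potentials {U : ℝ → ℝ} (hU0 : ∀ x, 0 ≤ U x) (hU1 : ContDiff ℝ 1 U) :
    ∃ V : ℕ → ℝ → ℝ, (∀ n, Differentiable ℝ (V n)) ∧ (∀ n x, 0 ≤ V n x) ∧
      (∀ n, ∃ K, LipschitzWith K (deriv (V n))) ∧ (∀ n, ∃ M, ∀ x, |deriv (V n) x| ≤ M) ∧
      (∀ R ε : ℝ, 0 < ε → ∀ᶠ n in atTop, ∀ x, |x| ≤ R → |deriv (V n) x - deriv U x| ≤ ε) ∧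
      ∀ x, ∃ C, ∀ n, V n x ≤ C := by
  have hUd : Differentiable ℝ U := hU1.differentiable one_ne_zero
  have hUc : Continuous (deriv U) := hU1.continuous_deriv le_rfl
  set c : ℕ → ℝ → ℝ := fun n x => max (-(n : ℝ)) (min n x) with hc
  have hcl : ∀ n, LipschitzWith 1 (c n) := fun n => (LipschitzWith.id.const_min _).const_max _
  have hcm : ∀ n x, |c n x| ≤ n := fun n x => abs_le.2
    ⟨le_max_left _ _, max_le (by linarith [n.cast_nonneg (α := ℝ)]) (min_le_left _ _)⟩
  have hci : ∀ (n : ℕ) (x : ℝ), |x| ≤ n → c n x = x := fun n x hx => by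
    rw [abs_le] at hx
    simp only [hc, min_eq_right hx.2, max_eq_right hx.1]
  have hcx : ∀ n x, |c n x| ≤ |x| := fun n x => by
    rcases le_total |x| n with h | h
    · rw [hci n x h]
    · exact (hcm n x).trans h
  have hWl : ∀ n, ∃ K, LipschitzWith K (fun x => U (c n x)) := by
    intro n
    obtain ⟨C, hC⟩ := (isCompact_Icc (a := -(n : ℝ)) (b := n)).exists_bound_of_continuousOn
      hUc.continuousOn
    refine ⟨C.toNNReal, LipschitzWith.of_dist_le_mul fun x y => ?_⟩
    have h1 := (convex_Icc (-(n : ℝ)) n).norm_image_sub_le_of_norm_hasDerivWithin_le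
      (fun x _ => (hUd x).hasDerivAt.hasDerivWithinAt) hC (abs_le.1 (hcm n y)) (abs_le.1 (hcm n x))
    have hC0 : 0 ≤ C := (norm_nonneg _).trans (hC (c n x) (abs_le.1 (hcm n x)))
    have h2 := (hcl n).dist_le_mul x y
    rw [Real.coe_toNNReal _ hC0, dist_eq_norm]
    refine h1.trans ?_
    rw [← dist_eq_norm]
    gcongr
    simpa using h2
  have hWc : ∀ n, Continuous fun x => U (c n x) := fun n => (hWl n).choose_spec.continuous
  set F : ℕ → ℝ → ℝ := fun n x => (n + 1) * (U (c n (x + 1 / (n + 1))) - U (c n x)) with hF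
  set V : ℕ → ℝ → ℝ := fun n x => (n + 1) * ∫ y in x..(x + 1 / (n + 1)), U (c n y) with hV
  have hp : ∀ n : ℕ, (0 : ℝ) < 1 / (n + 1) := fun n => by positivity
  have hVd : ∀ n x, HasDerivAt (V n) (F n x) x := by
    intro n x
    have hG : ∀ y, HasDerivAt (fun y => ∫ u in (0 : ℝ)..y, U (c n u)) (U (c n y)) y := fun y =>
      intervalIntegral.integral_hasDerivAt_right ((hWc n).intervalIntegrable _ _)
        ((hWc n).stronglyMeasurableAtFilter _ _) (hWc n).continuousAt
    have h1 := (((hG (x + 1 / (n + 1))).comp_add_const x (1 / ((n : ℝ) + 1))).sub (hG x)).const_mul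
      ((n : ℝ) + 1)
    refine h1.congr_of_eventuallyEq (Eventually.of_forall fun y => ?_)
    simp only [hV, Pi.sub_apply]
    rw [intervalIntegral.integral_interval_sub_left] <;> exact (hWc n).intervalIntegrable _ _
  have hVF : ∀ n, deriv (V n) = F n := fun n => funext fun x => (hVd n x).deriv
  refine ⟨V, fun n x => (hVd n x).differentiableAt, fun n x => ?_, fun n => ?_, fun n => ?_, ?_, ?_⟩
  · exact mul_nonneg (by positivity)
      (intervalIntegral.integral_nonneg (by linarith [hp n]) fun _ _ => hU0 _)
  · obtain ⟨K, hK⟩ := hWl n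
    rw [hVF]
    have h1 : LipschitzWith (K * 1) fun x : ℝ => U (c n (x + 1 / (n + 1))) :=
      hK.comp (LipschitzWith.of_dist_le_mul fun x y => by simp)
    have h2 := (h1.sub hK)
    refine ⟨‖(n : ℝ) + 1‖₊ * (K * 1 + K), LipschitzWith.of_dist_le_mul fun x y => ?_⟩
    have h3 := h2.dist_le_mul x y
    rw [Real.dist_eq] at h3 ⊢
    simp only [hF, ← mul_sub, abs_mul, NNReal.coe_mul, coe_nnnorm, Real.norm_eq_abs, mul_assoc]
    gcongr
  · obtain ⟨C, hC⟩ := (isCompact_Icc (a := -(n : ℝ)) (b := n)).exists_bound_of_continuousOn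
      hUd.continuous.continuousOn
    refine ⟨(n + 1) * (C + C), fun x => ?_⟩
    rw [hVF, abs_mul, abs_of_pos (by positivity : (0 : ℝ) < n + 1)]
    gcongr
    exact (abs_sub _ _).trans (add_le_add (hC _ (abs_le.1 (hcm _ _))) (hC _ (abs_le.1 (hcm _ _))))
  · intro R ε hε
    have huc := (isCompact_closedBall (0 : ℝ) (R + 1)).uniformContinuousOn_of_continuous
      hUc.continuousOn
    obtain ⟨δ, hδ, h⟩ := Metric.uniformContinuousOn_iff.1 huc ε hε
    have hlim := tendsto_one_div_add_atTop_nhds_zero_nat (𝕜 := ℝ)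
    filter_upwards [hlim.eventually (gt_mem_nhds hδ), hlim.eventually (gt_mem_nhds one_pos),
      tendsto_natCast_atTop_atTop.eventually (eventually_ge_atTop (R + 1))] with n h1 h2 h3 x hx
    have hpn := hp n
    obtain ⟨y, hy, hyd⟩ := exists_deriv_eq_slope U (show x < x + 1 / (n + 1) by linarith)
      hUd.continuous.continuousOn hUd.differentiableOn
    have hxx := abs_le.1 hx
    rw [hVF]
    simp only [hF]
    rw [hci n _ (abs_le.2 ⟨by linarith, by linarith⟩), hci n x (by linarith)]
    have h4 : ((n : ℝ) + 1) * (U (x + 1 / (n + 1)) - U x) = deriv U y := by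
      rw [hyd]
      field_simp
      ring_nf
    rw [h4, ← Real.dist_eq]
    refine (h y ?_ x ?_ ?_).le
    · simp only [mem_closedBall_zero_iff, Real.norm_eq_abs]
      exact abs_le.2 ⟨by linarith [hy.1], by linarith [hy.2]⟩
    · simp only [mem_closedBall_zero_iff, Real.norm_eq_abs]
      linarith
    · rw [Real.dist_eq, abs_of_pos (by linarith [hy.1])]
      linarith [hy.2]
  · intro x
    obtain ⟨C, hC⟩ := (isCompact_closedBall (0 : ℝ) (|x| + 1)).exists_bound_of_continuousOn
      hUd.continuous.continuousOn
    refine ⟨C, fun n => ?_⟩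
    have hpn := hp n
    have h1 : ∫ y in x..(x + 1 / (n + 1)), U (c n y) ≤ ∫ y in x..(x + 1 / ((n : ℝ) + 1)), C := by
      refine intervalIntegral.integral_mono_on (by linarith) ((hWc n).intervalIntegrable _ _)
        (by simp) fun y hy => ?_
      refine (le_abs_self _).trans (hC _ ?_)
      rw [mem_closedBall_zero_iff, Real.norm_eq_abs]
      refine (hcx n y).trans ?_
      have h2 : 1 / ((n : ℝ) + 1) ≤ 1 := by
        rw [div_le_one (by positivity)]
        linarith [n.cast_nonneg (α := ℝ)]
      have h3 := abs_sub_abs_le_abs_sub y x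
      rw [abs_of_nonneg (sub_nonneg.2 hy.1)] at h3
      linarith [hy.2]
    calc V n x ≤ (n + 1) * ∫ y in x..(x + 1 / ((n : ℝ) + 1)), C := by
          simp only [hV]
          gcongr
      _ = C := by
          rw [intervalIntegral.integral_const]
          simp only [add_sub_cancel_left, smul_eq_mul]
          field_simp

/-- The Hamiltonian vector field of a potential with derivative `F`. -/
def hamiltonianField (F : ℝ → ℝ) (y : Phase) : Phase := (y.2, -F y.1)

theorem exists_limit_hamiltonianPath {ι : Type*} (l : Ultrafilter ι) {U : ℝ → ℝ}
    (hU1 : ContDiff ℝ 1 U) {V : ι → ℝ → ℝ} (hVd : ∀ i, Differentiable ℝ (V i))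
    (hV0 : ∀ i x, 0 ≤ V i x)
    (hVU : ∀ R ε : ℝ, 0 < ε → ∀ᶠ i in (l : Filter ι), ∀ x, |x| ≤ R →
      |deriv (V i) x - deriv U x| ≤ ε)
    {γ : ι → ℝ → Phase}
    (hγ : ∀ T : ℝ, ∀ᶠ i in (l : Filter ι), ∀ s, |s| < T →
      HasDerivAt (γ i) (hamiltonianField (deriv (V i)) (γ i s)) s)
    {C : ℝ} (hC : ∀ᶠ i in (l : Filter ι), V i (γ i 0).1 ≤ C)
    {z : Phase} (h0 : Tendsto (fun i => γ i 0) l (𝓝 z)) :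
    ∃ γ' : ℝ → Phase, IsHamiltonianPath U γ' ∧ γ' 0 = z ∧
      ∀ t, Tendsto (fun i => γ i t) l (𝓝 (γ' t)) := by
  have hUc : Continuous (deriv U) := hU1.continuous_deriv le_rfl
  refine exists_limit_trajectory l (b := hamiltonianField (deriv U))
    (B := fun i => hamiltonianField (deriv (V i))) (by unfold hamiltonianField; fun_prop) ?_ ?_ h0
  · intro R ε hε
    filter_upwards [hVU R ε hε] with i hi y hy
    rw [Prod.norm_def]
    simp only [hamiltonianField, Prod.fst_sub, Prod.snd_sub, sub_self, norm_zero]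
    refine max_le hε.le ?_
    rw [← neg_sub', norm_neg, Real.norm_eq_abs]
    exact hi _ ((norm_fst_le y).trans hy)
  · intro T
    -- D bounds the velocity through the energy and R the position up to time T; the added 1's allow
    -- for initial states within distance 1 of z. In the bound for the field, M + 1 allows for the
    -- error between the two forces.
    set D := √((|z.2| + 1) ^ 2 + 2 * C) with hD
    set R := |z.1| + 1 + D * |T| with hR
    obtain ⟨M, hM⟩ := (isCompact_closedBall (0 : ℝ) R).exists_bound_of_continuousOn
      hUc.continuousOn
    refine ⟨max D (M + 1), ?_⟩
    filter_upwards [hγ T, hC, h0 (Metric.ball_mem_nhds z one_pos), hVU R 1 one_pos]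
      with i h1 h2 h3 h4 s hs
    refine ⟨h1 s hs, ?_⟩
    have h3' : ‖γ i 0 - z‖ < 1 := by simpa [dist_eq_norm] using h3
    have hx0 : |(γ i 0).1| ≤ |z.1| + 1 := by
      have := norm_fst_le (γ i 0 - z)
      have h5 := abs_sub_abs_le_abs_sub (γ i 0).1 z.1
      simp only [Prod.fst_sub, Real.norm_eq_abs] at this
      linarith
    have hv0 : |(γ i 0).2| ≤ |z.2| + 1 := by
      have := norm_snd_le (γ i 0 - z)
      have h5 := abs_sub_abs_le_abs_sub (γ i 0).2 z.2
      simp only [Prod.snd_sub, Real.norm_eq_abs] at this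
      linarith
    have hv : ∀ r, |r| < T → |(γ i r).2| ≤ D := by
      intro r hr
      refine (abs_velocity_le (hVd i) (hV0 i) h1 hr).trans (Real.sqrt_le_sqrt ?_)
      have : (γ i 0).2 ^ 2 ≤ (|z.2| + 1) ^ 2 := sq_le_sq' (by linarith [(abs_le.1 hv0).1])
        (abs_le.1 hv0).2
      linarith
    have hx : |(γ i s).1| ≤ R := by
      have hT : 0 < T := (abs_nonneg s).trans_lt hs
      have h5 : ‖(γ i s).1 - (γ i 0).1‖ ≤ D * ‖s - 0‖ := by
        refine (convex_ball (0 : ℝ) T).norm_image_sub_le_of_norm_hasDerivWithin_le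
          (f := fun r => (γ i r).1) (f' := fun r => (γ i r).2)
          (fun r hr => (hasDerivAt_components (h1 r (by simpa using hr))).1.hasDerivWithinAt)
          (fun r hr => hv r (by simpa using hr)) (by simpa using hT) (by simpa using hs)
      have h6 := abs_sub_abs_le_abs_sub (γ i s).1 (γ i 0).1
      have h7 : D * |s| ≤ D * |T| := by
        exact mul_le_mul_of_nonneg_left (hs.le.trans (le_abs_self T)) (Real.sqrt_nonneg _)
      simp only [Real.norm_eq_abs, sub_zero] at h5
      linarith
    rw [Prod.norm_def]
    refine max_le_max (hv s hs) ?_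
    have h5 := h4 _ hx
    have h6 := hM _ (mem_closedBall_zero_iff.2 hx)
    have h7 := abs_sub_abs_le_abs_sub (deriv (V i) (γ i s).1) (deriv U (γ i s).1)
    simp only [hamiltonianField, norm_neg, Real.norm_eq_abs] at h6 ⊢
    linarith

/-- A Peano existence theorem, global in time because of the energy bound. The n-th approximate path
solves its equation only for |s| < n + 1, which eventually contains any bounded interval. -/
theorem exists_isHamiltonianPath {U : ℝ → ℝ} (hU0 : ∀ x, 0 ≤ U x) (hU1 : ContDiff ℝ 1 U)
    (z : Phase) : ∃ γ, IsHamiltonianPath U γ ∧ γ 0 = z := by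
  obtain ⟨V, hVd, hV0, hVl, hVb, hVU, hVC⟩ := exists_lipschitz_potentials hU0 hU1
  have : ∀ n : ℕ, ∃ γ : ℝ → Phase, γ 0 = z ∧ ∀ s, |s| < (n : ℝ) + 1 →
      HasDerivAt γ (hamiltonianField (deriv (V n)) (γ s)) s := fun n => by
    obtain ⟨K, hK⟩ := hVl n
    obtain ⟨M, hM⟩ := hVb n
    exact exists_trajectory_of_lipschitzWith (F := fun x => -deriv (V n) x) hK.neg
      (by simpa using hM) (by positivity) z
  choose γ h0 hγ using this
  obtain ⟨C, hC⟩ := hVC z.1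
  have hl : ((Ultrafilter.of atTop : Ultrafilter ℕ) : Filter ℕ) ≤ atTop := Ultrafilter.of_le _
  have hT : ∀ T : ℝ, ∀ᶠ n in (atTop : Filter ℕ), ∀ s, |s| < T →
      HasDerivAt (γ n) (hamiltonianField (deriv (V n)) (γ n s)) s := fun T => by
    filter_upwards [tendsto_natCast_atTop_atTop.eventually (eventually_ge_atTop T)] with n hn s hs
    exact hγ n s (by linarith)
  obtain ⟨γ', h1, h2, -⟩ := exists_limit_hamiltonianPath (Ultrafilter.of (atTop : Filter ℕ)) hU1 hVd
    hV0 (fun R ε hε => hl (hVU R ε hε)) (γ := γ) (C := C) (z := z)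
    (fun T => hl (hT T)) (Eventually.of_forall fun n => by rw [h0]; exact hC n)
    (by simp only [h0]; exact tendsto_const_nhds)
  exact ⟨γ', h1, h2⟩

/-! ### Group property and continuity of the flow. -/

section Flow

variable {U : ℝ → ℝ}

theorem hamiltonianFlow_spec (hU0 : ∀ x, 0 ≤ U x) (hU1 : ContDiff ℝ 1 U) (z : Phase) :
    IsHamiltonianPath U (fun t => hamiltonianFlow U t z) ∧ hamiltonianFlow U 0 z = z :=
  Classical.epsilon_spec (exists_isHamiltonianPath hU0 hU1 z)

theorem hamiltonianFlow_zero (hU0 : ∀ x, 0 ≤ U x) (hU1 : ContDiff ℝ 1 U) (z : Phase) :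
    hamiltonianFlow U 0 z = z := (hamiltonianFlow_spec hU0 hU1 z).2

theorem hamiltonianFlow_add (hU0 : ∀ x, 0 ≤ U x) (hU1 : ContDiff ℝ 1 U)
    (hU : HamiltonianUniqueness U) (s t : ℝ) (z : Phase) :
    hamiltonianFlow U (s + t) z = hamiltonianFlow U t (hamiltonianFlow U s z) := by
  have h := hU (fun t => hamiltonianFlow U (s + t) z)
    (fun t => hamiltonianFlow U t (hamiltonianFlow U s z))
    (fun t => ((hamiltonianFlow_spec hU0 hU1 z).1 (s + t)).comp_const_add s t)
    (hamiltonianFlow_spec hU0 hU1 _).1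
    (by simp [(hamiltonianFlow_spec hU0 hU1 _).2])
  exact congrFun h t

/-- Along an ultrafilter of initial states tending to z, the trajectories converge to some
trajectory from z; uniqueness identifies it with the flow. -/
theorem continuous_hamiltonianFlow (hU0 : ∀ x, 0 ≤ U x) (hU1 : ContDiff ℝ 1 U)
    (hU : HamiltonianUniqueness U) (t : ℝ) : Continuous (hamiltonianFlow U t) := by
  rw [continuous_iff_continuousAt]
  intro z
  rw [ContinuousAt, tendsto_iff_ultrafilter]
  intro l hl
  have hl' : Tendsto (fun y : Phase => y) (l : Filter Phase) (𝓝 z) := hl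
  have h4 : Tendsto (fun y : Phase => U y.1) l (𝓝 (U z.1)) :=
    ((hU1.continuous.comp continuous_fst).tendsto z).comp hl'
  have h5 : ∀ᶠ y in (l : Filter Phase), U (hamiltonianFlow U 0 y).1 ≤ U z.1 + 1 := by
    simp only [hamiltonianFlow_zero hU0 hU1]
    filter_upwards [h4.eventually (gt_mem_nhds (lt_add_one _))] with y hy using hy.le
  obtain ⟨γ, h1, h2, h3⟩ := exists_limit_hamiltonianPath l hU1 (V := fun _ => U)
    (fun _ => hU1.differentiable one_ne_zero) (fun _ => hU0)
    (fun R ε hε => Eventually.of_forall fun _ _ _ => by simpa using hε.le)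
    (γ := fun y t => hamiltonianFlow U t y) (C := U z.1 + 1) (z := z)
    (fun T => Eventually.of_forall fun y s _ => (hamiltonianFlow_spec hU0 hU1 y).1 s) h5
    (by simpa only [hamiltonianFlow_zero hU0 hU1] using hl')
  have : γ = fun t => hamiltonianFlow U t z := hU _ _ h1 (hamiltonianFlow_spec hU0 hU1 z).1
    (by rw [h2, hamiltonianFlow_zero hU0 hU1])
  simpa only [this] using h3 t

/-- Along the flow, the velocity is bounded in terms of the initial energy. -/
theorem abs_flow_velocity_le (hU0 : ∀ x, 0 ≤ U x) (hU1 : ContDiff ℝ 1 U) (t : ℝ) (z : Phase) :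
    |(hamiltonianFlow U t z).2| ≤ √(z.2 ^ 2 + 2 * U z.1) := by
  have h := hamiltonianFlow_spec hU0 hU1 z
  have := abs_velocity_le (hU1.differentiable one_ne_zero) hU0 (T := |t| + 1)
    (γ := fun t => hamiltonianFlow U t z) (fun s _ => h.1 s) (s := t) (by linarith)
  simpa only [h.2] using this

/-- Near (t, z) the speed is bounded by the energy, so the flow is Lipschitz in time uniformly in
the starting point. Continuity in space at the single time t then suffices. -/
theorem continuous_uncurry_hamiltonianFlow (hU0 : ∀ x, 0 ≤ U x) (hU1 : ContDiff ℝ 1 U)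
    (hU : HamiltonianUniqueness U) :
    Continuous fun p : ℝ × Phase => hamiltonianFlow U p.1 p.2 := by
  have hUc : Continuous (deriv U) := hU1.continuous_deriv le_rfl
  rw [continuous_iff_continuousAt]
  rintro ⟨t, z⟩
  obtain ⟨D, hD⟩ := (isCompact_closedBall z 1).exists_bound_of_continuousOn
    (f := fun z : Phase => √(z.2 ^ 2 + 2 * U z.1)) (by
      have := hU1.continuous
      fun_prop)
  have hD0 : 0 ≤ D := (norm_nonneg _).trans (hD z (by simp))
  set R := |z.1| + 1 + D * (|t| + 1) with hR
  obtain ⟨M, hM⟩ := (isCompact_closedBall (0 : ℝ) R).exists_bound_of_continuousOn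
    hUc.continuousOn
  have hv : ∀ y ∈ Metric.closedBall z 1, ∀ s, |(hamiltonianFlow U s y).2| ≤ D := fun y hy s =>
    (abs_flow_velocity_le hU0 hU1 s y).trans ((le_abs_self _).trans (hD y hy))
  have hx : ∀ y ∈ Metric.closedBall z 1, ∀ s ∈ Metric.ball t 1,
      |(hamiltonianFlow U s y).1| ≤ R := by
    intro y hy s hs
    have h5 : ‖(hamiltonianFlow U s y).1 - (hamiltonianFlow U 0 y).1‖ ≤ D * ‖s - 0‖ :=
      convex_univ.norm_image_sub_le_of_norm_hasDerivWithin_le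
        (f := fun r => (hamiltonianFlow U r y).1) (f' := fun r => (hamiltonianFlow U r y).2)
        (fun r _ => (hasDerivAt_components
          ((hamiltonianFlow_spec hU0 hU1 y).1 r)).1.hasDerivWithinAt)
        (fun r _ => hv y hy r) trivial trivial
    rw [hamiltonianFlow_zero hU0 hU1] at h5
    have h6 := abs_sub_abs_le_abs_sub (hamiltonianFlow U s y).1 y.1
    have h8 : |s| ≤ |t| + 1 := by
      have := abs_sub_abs_le_abs_sub s t
      have : |s - t| < 1 := hs
      linarith
    have h7 : D * |s| ≤ D * (|t| + 1) := mul_le_mul_of_nonneg_left h8 hD0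
    have h9 : |y.1| ≤ |z.1| + 1 := by
      have h10 : ‖y - z‖ ≤ 1 := by simpa [dist_eq_norm] using hy
      have := norm_fst_le (y - z)
      have h5 := abs_sub_abs_le_abs_sub y.1 z.1
      simp only [Prod.fst_sub, Real.norm_eq_abs] at this
      linarith
    simp only [Real.norm_eq_abs, sub_zero] at h5
    linarith
  have lip : ∀ y ∈ Metric.closedBall z 1, ∀ s ∈ Metric.ball t 1,
      dist (hamiltonianFlow U s y) (hamiltonianFlow U t y) ≤ max D M * dist s t := by
    intro y hy s hs
    rw [dist_eq_norm, dist_eq_norm]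
    refine (convex_ball t 1).norm_image_sub_le_of_norm_hasDerivWithin_le
      (f := fun r => hamiltonianFlow U r y)
      (fun r _ => ((hamiltonianFlow_spec hU0 hU1 y).1 r).hasDerivWithinAt) (fun r hr => ?_)
      (Metric.mem_ball_self one_pos) hs
    rw [Prod.norm_def]
    refine max_le_max (hv y hy r) ?_
    rw [norm_neg]
    exact hM _ (mem_closedBall_zero_iff.2 (hx y hy r hr))
  rw [ContinuousAt, tendsto_iff_dist_tendsto_zero]
  have h1 : Tendsto (fun p : ℝ × Phase => max D M * dist p.1 t +
      dist (hamiltonianFlow U t p.2) (hamiltonianFlow U t z)) (𝓝 (t, z)) (𝓝 0) := by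
    have hc := continuous_hamiltonianFlow hU0 hU1 hU t
    have : Continuous fun p : ℝ × Phase => max D M * dist p.1 t +
      dist (hamiltonianFlow U t p.2) (hamiltonianFlow U t z) := by fun_prop
    simpa using this.tendsto (t, z)
  refine squeeze_zero' (Eventually.of_forall fun _ => dist_nonneg) ?_ h1
  filter_upwards [prod_mem_nhds (Metric.ball_mem_nhds t one_pos)
    (Metric.closedBall_mem_nhds z one_pos)] with p hp
  exact (dist_triangle _ _ _).trans (add_le_add (lip _ hp.2 _ hp.1) le_rfl)

theorem lipschitzWith_hamiltonianField {F : ℝ → ℝ} {K : NNReal} (hF : LipschitzWith K F) :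
    LipschitzWith (max 1 K) (hamiltonianField F) :=
  LipschitzWith.prodMk LipschitzWith.prod_snd
    (by
      have := (hF.comp (LipschitzWith.prod_fst (α := ℝ) (β := ℝ))).neg
      rwa [mul_one] at this)

theorem hamiltonianUniqueness_of_lipschitzWith {K : NNReal} (hF : LipschitzWith K (deriv U)) :
    HamiltonianUniqueness U := fun _ _ h1 h2 h0 =>
  ODE_solution_unique_univ (v := fun _ => hamiltonianField (deriv U)) (s := fun _ => Set.univ)
    (fun _ => (lipschitzWith_hamiltonianField hF).lipschitzOnWith)
    (fun t => ⟨h1 t, trivial⟩) (fun t => ⟨h2 t, trivial⟩) h0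

theorem exists_lipschitzWith_deriv (hU : ContDiff ℝ ∞ U)
    (h : ∃ M : ℝ, ∀ x, |iteratedDeriv 2 U x| ≤ M) : ∃ K, LipschitzWith K (deriv U) := by
  obtain ⟨M, hM⟩ := h
  have hd : Differentiable ℝ (deriv U) := by
    have := hU.differentiable_iteratedDeriv 1 (by simp)
    rwa [iteratedDeriv_one] at this
  refine ⟨M.toNNReal, lipschitzWith_of_nnnorm_deriv_le hd fun x => ?_⟩
  have h1 := hM x
  rw [iteratedDeriv_succ, iteratedDeriv_one] at h1
  rw [← NNReal.coe_le_coe, Real.coe_toNNReal _ ((abs_nonneg _).trans h1)]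
  exact h1

end Flow

end Hamiltonian

/-! ### Lack of memory of the exponential law. -/

section ExponentialLaw

theorem expMeasure_Ioi {lam : ℝ} (hlam : 0 < lam) {s : ℝ} (hs : 0 ≤ s) :
    expMeasure lam (Set.Ioi s) = ENNReal.ofReal (Real.exp (-(lam * s))) := by
  have := isProbabilityMeasure_expMeasure hlam
  have h := cdf_expMeasure_eq hlam s
  rw [if_pos hs, cdf_eq_real] at h
  rw [← Set.compl_Iic, ← ofReal_measureReal, probReal_compl_eq_one_sub measurableSet_Iic, h]
  simp

theorem expMeasure_real_Iic {lam : ℝ} (hlam : 0 < lam) {s : ℝ} (hs : 0 ≤ s) :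
    (expMeasure lam).real (Set.Iic s) = 1 - Real.exp (-(lam * s)) := by
  have := isProbabilityMeasure_expMeasure hlam
  have h := cdf_expMeasure_eq hlam s
  rwa [if_pos hs, cdf_eq_real] at h

theorem expMeasure_memoryless {lam : ℝ} (hlam : 0 < lam) {s : ℝ} (hs : 0 ≤ s) :
    (expMeasure lam).restrict (Set.Ioi s) =
      expMeasure lam (Set.Ioi s) • (expMeasure lam).map (fun x => s + x) := by
  have := isProbabilityMeasure_expMeasure hlam
  ext A hA
  have hA' : MeasurableSet ((fun x => s + x) ⁻¹' A) := (measurable_const_add s) hA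
  have hd : ∀ B, MeasurableSet B → expMeasure lam B = ∫⁻ x in B, exponentialPDF lam x :=
    fun B hB => withDensity_apply _ hB
  have h0 : expMeasure lam ((fun x => s + x) ⁻¹' A) =
      expMeasure lam ((fun x => s + x) ⁻¹' A ∩ Set.Ioi 0) := by
    have : expMeasure lam (Set.Ioi 0)ᶜ = 0 := by
      rw [prob_compl_eq_zero_iff measurableSet_Ioi, expMeasure_Ioi hlam le_rfl]
      simp
    rw [measure_inter_conull' (measure_mono_null (fun x hx => hx.2) this)]
  rw [Measure.restrict_apply hA, Measure.smul_apply, Measure.map_apply (measurable_const_add s) hA,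
    h0, expMeasure_Ioi hlam hs, hd _ (hA.inter measurableSet_Ioi),
    hd _ (hA'.inter measurableSet_Ioi), smul_eq_mul, ← lintegral_const_mul _ (by
      exact (measurable_exponentialPDFReal lam).ennreal_ofReal),
    ← lintegral_indicator (hA.inter measurableSet_Ioi),
    ← lintegral_indicator (hA'.inter measurableSet_Ioi),
    ← lintegral_add_left_eq_self _ s]
  congr 1
  ext x
  by_cases hx : x ∈ (fun x => s + x) ⁻¹' A ∩ Set.Ioi 0
  · have h2 : (0 : ℝ) < x := hx.2
    have h1 : s + x ∈ A ∩ Set.Ioi s := ⟨hx.1, by simpa using h2⟩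
    rw [Set.indicator_of_mem h1, Set.indicator_of_mem hx, exponentialPDF_of_nonneg (by linarith),
      exponentialPDF_of_nonneg h2.le, ← ENNReal.ofReal_mul (Real.exp_pos _).le]
    congr 1
    rw [mul_left_comm, ← Real.exp_add]
    ring_nf
  · have h1 : s + x ∉ A ∩ Set.Ioi s := fun h => hx ⟨h.1, by simpa using h.2⟩
    rw [Set.indicator_of_notMem h1, Set.indicator_of_notMem hx]

/-- The law of one waiting time and one refreshment variable. -/
noncomputable def stepLaw (lam : ℝ) : Measure (ℝ × ℝ) := (expMeasure lam).prod (gaussianReal 0 1)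

theorem isProbabilityMeasure_stepLaw {lam : ℝ} (hlam : 0 < lam) :
    IsProbabilityMeasure (stepLaw lam) := by
  have := isProbabilityMeasure_expMeasure hlam
  unfold stepLaw
  infer_instance

theorem isProbabilityMeasure_noiseLaw {lam : ℝ} (hlam : 0 < lam) :
    IsProbabilityMeasure (noiseLaw lam) := by
  have := isProbabilityMeasure_expMeasure hlam
  unfold noiseLaw
  infer_instance

theorem ae_expMeasure_pos {lam : ℝ} (hlam : 0 < lam) : ∀ᵐ x ∂expMeasure lam, 0 < x := by
  have := isProbabilityMeasure_expMeasure hlam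
  have h : {a : ℝ | ¬0 < a} = (Set.Ioi 0)ᶜ := rfl
  rw [ae_iff, h, prob_compl_eq_zero_iff measurableSet_Ioi, expMeasure_Ioi hlam le_rfl]
  simp

theorem ae_stepLaw_pos {lam : ℝ} (hlam : 0 < lam) : ∀ᵐ a ∂stepLaw lam, 0 < a.1 :=
  Measure.quasiMeasurePreserving_fst.ae (ae_expMeasure_pos hlam)

/-- The attached Gaussian is independent of the waiting time and passes through unchanged. The
product form is the one that appears when the law of `splice` is split at the first waiting time. -/
theorem stepLaw_memoryless {lam : ℝ} (hlam : 0 < lam) {s : ℝ} (hs : 0 ≤ s) {B : Set (ℝ × ℝ)}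
    (hB : MeasurableSet B) :
    stepLaw lam {a | s < a.1} * stepLaw lam {a | (s + a.1, a.2) ∈ B} =
      stepLaw lam (B ∩ {a | s < a.1}) := by
  have := isProbabilityMeasure_expMeasure hlam
  have e : {a : ℝ × ℝ | s < a.1} = Set.Ioi s ×ˢ Set.univ := by ext; simp
  have h1 : stepLaw lam {a | s < a.1} = expMeasure lam (Set.Ioi s) := by
    rw [e, stepLaw, Measure.prod_prod, measure_univ, mul_one]
  have h2 : (stepLaw lam).restrict (Set.Ioi s ×ˢ Set.univ) = expMeasure lam (Set.Ioi s) •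
      (stepLaw lam).map (Prod.map (fun x => s + x) id) := by
    rw [stepLaw, ← Measure.prod_restrict, expMeasure_memoryless hlam hs, Measure.restrict_univ,
      Measure.prod_smul_left, ← Measure.map_prod_map _ _ (measurable_const_add s) measurable_id,
      Measure.map_id]
  rw [h1, e, ← Measure.restrict_apply hB, h2, Measure.smul_apply,
    Measure.map_apply ((measurable_const_add s).prodMap measurable_id) hB]
  rfl

end ExponentialLaw

/-! ### Sequences of independent variables and their first term. -/

section Sequences

variable {X : Type*}

/-- The sequence without its first term. -/
def shiftSeq (w : ℕ → X) : ℕ → X := fun n => w (n + 1)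

/-- The sequence with first term `a`, followed by `w`. -/
def consSeq (a : X) (w : ℕ → X) : ℕ → X
  | 0 => a
  | n + 1 => w n

@[simp] theorem consSeq_zero (a : X) (w : ℕ → X) : consSeq a w 0 = a := rfl

@[simp] theorem consSeq_succ (a : X) (w : ℕ → X) (n : ℕ) : consSeq a w (n + 1) = w n := rfl

theorem forall_lt_succ_consSeq {a : X} {w : ℕ → X} {n : ℕ} {B : ℕ → Set X} :
    (∀ i < n + 1, consSeq a w i ∈ B i) ↔ a ∈ B 0 ∧ ∀ i < n, w i ∈ B (i + 1) := by
  refine ⟨fun h => ⟨h 0 n.succ_pos, fun i hi => h (i + 1) (by omega)⟩, fun h i hi => ?_⟩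
  cases i with
  | zero => exact h.1
  | succ i => exact h.2 i (by omega)

variable [MeasurableSpace X]

/-- Sequences are determined in law by their initial segments. -/
theorem eq_infinitePi_of_initial (m : Measure X) [IsProbabilityMeasure m] {ν : Measure (ℕ → X)}
    (h : ∀ (n : ℕ) (B : ℕ → Set X), (∀ i, MeasurableSet (B i)) →
      ν {w | ∀ i < n, w i ∈ B i} = ∏ i ∈ Finset.range n, m (B i)) :
    ν = Measure.infinitePi fun _ => m := by
  classical
  refine Measure.eq_infinitePi _ fun s t ht => ?_
  obtain ⟨n, hn⟩ := s.exists_nat_subset_range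
  have h1 := h n (fun i => if i ∈ s then t i else Set.univ) (fun i => by
    split_ifs
    exacts [ht i, MeasurableSet.univ])
  have h2 : {w : ℕ → X | ∀ i < n, w i ∈ if i ∈ s then t i else Set.univ} = Set.pi s t := by
    ext w
    simp only [Set.mem_ofPred_eq, Set.mem_pi, Finset.mem_coe]
    refine ⟨fun hw i hi => ?_, fun hw i _ => ?_⟩
    · simpa [hi] using hw i (Finset.mem_range.1 (hn hi))
    · by_cases hi : i ∈ s <;> simp [hi, hw i]
  rw [← h2, h1, ← Finset.prod_subset hn (f := fun i => m (if i ∈ s then t i else Set.univ))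
    (fun i _ hi => by simp [hi])]
  exact Finset.prod_congr rfl fun i hi => by simp [hi]

theorem infinitePi_initial (m : Measure X) [IsProbabilityMeasure m] (n : ℕ) {B : ℕ → Set X}
    (hB : ∀ i, MeasurableSet (B i)) :
    Measure.infinitePi (fun _ : ℕ => m) {w | ∀ i < n, w i ∈ B i} =
      ∏ i ∈ Finset.range n, m (B i) := by
  rw [← Measure.infinitePi_pi (s := Finset.range n) (t := B) (fun _ => m) fun i _ => hB i]
  congr 1
  ext w
  simp

theorem measurable_shiftSeq : Measurable (shiftSeq : (ℕ → X) → ℕ → X) := by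
  unfold shiftSeq
  fun_prop

theorem measurable_consSeq : Measurable fun p : X × (ℕ → X) => consSeq p.1 p.2 := by
  rw [measurable_pi_iff]
  rintro (_ | n)
  · exact measurable_fst
  · exact (measurable_pi_apply n).comp measurable_snd

/-- This is conditioning on the first step; it serves both for the law of `splice` and for the
decomposition at the first refreshment. -/
theorem measurePreserving_consSeq (m : Measure X) [IsProbabilityMeasure m] :
    MeasurePreserving (fun p : X × (ℕ → X) => consSeq p.1 p.2)
      (m.prod (Measure.infinitePi fun _ => m)) (Measure.infinitePi fun _ => m) := by
  refine ⟨measurable_consSeq, eq_infinitePi_of_initial m fun n B hB => ?_⟩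
  have hms : MeasurableSet {w : ℕ → X | ∀ i < n, w i ∈ B i} := by
    simp only [Set.ofPred_forall]
    exact .iInter fun i => .iInter fun _ => measurable_pi_apply i (hB i)
  rw [Measure.map_apply measurable_consSeq hms]
  cases n with
  | zero => simp
  | succ n =>
    have : (fun p : X × (ℕ → X) => consSeq p.1 p.2) ⁻¹' {w | ∀ i < n + 1, w i ∈ B i} =
        B 0 ×ˢ {w | ∀ i < n, w i ∈ B (i + 1)} := by
      ext p
      simp only [Set.mem_preimage, Set.mem_ofPred_eq, forall_lt_succ_consSeq, Set.mem_prod]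
    rw [this, Measure.prod_prod, infinitePi_initial m n fun i => hB (i + 1),
      Finset.prod_range_succ', mul_comm]

end Sequences

/-- The Hamiltonian flow of `U` is a continuous flow. -/
structure IsContinuousFlow (U : ℝ → ℝ) : Prop where
  zero : ∀ z, hamiltonianFlow U 0 z = z
  add : ∀ s t z, hamiltonianFlow U (s + t) z = hamiltonianFlow U t (hamiltonianFlow U s z)
  continuous : Continuous fun p : ℝ × Phase => hamiltonianFlow U p.1 p.2

theorem isContinuousFlow_of_uniqueness {U : ℝ → ℝ} (hU0 : ∀ x, 0 ≤ U x) (hU1 : ContDiff ℝ 1 U)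
    (hU : HamiltonianUniqueness U) : IsContinuousFlow U :=
  ⟨hamiltonianFlow_zero hU0 hU1, hamiltonianFlow_add hU0 hU1 hU,
    continuous_uncurry_hamiltonianFlow hU0 hU1 hU⟩

theorem IsContinuousFlow.continuous_time {U : ℝ → ℝ} (h : IsContinuousFlow U) (t : ℝ) :
    Continuous (hamiltonianFlow U t) :=
  h.continuous.comp (Continuous.prodMk_right t)

/-! ### Renewal equation, measurability and non-explosion. -/

section Renewal

/-- Noise for which the refreshment times are increasing and unbounded. -/
def goodNoise : Set (ℕ → ℝ × ℝ) := {w | (∀ n, 0 < (w n).1) ∧ ∀ t, ∃ n, t < refreshTime w n}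

theorem refreshTime_succ (w : ℕ → ℝ × ℝ) (n : ℕ) :
    refreshTime w (n + 1) = (w 0).1 + refreshTime (shiftSeq w) n := by
  simp only [refreshTime, shiftSeq]
  rw [Finset.sum_range_succ', add_comm]

theorem shiftSeq_mem_goodNoise {w : ℕ → ℝ × ℝ} (hw : w ∈ goodNoise) :
    shiftSeq w ∈ goodNoise := by
  refine ⟨fun n => hw.1 (n + 1), fun t => ?_⟩
  obtain ⟨n, hn⟩ := hw.2 (t + (w 0).1)
  refine ⟨n, ?_⟩
  have h1 := refreshTime_succ w n
  have h2 : refreshTime w (n + 1) = refreshTime w n + (w n).1 := Finset.sum_range_succ _ _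
  have h3 := hw.1 n
  linarith

theorem monotone_refreshTime {w : ℕ → ℝ × ℝ} (hw : w ∈ goodNoise) : Monotone (refreshTime w) :=
  monotone_nat_of_le_succ fun n => by
    have h2 : refreshTime w (n + 1) = refreshTime w n + (w n).1 := Finset.sum_range_succ _ _
    have h3 := hw.1 n
    linarith

/-- `Set.ncard` vanishes on infinite sets, so finiteness is what makes `refreshCount` an actual
count. -/
theorem finite_refreshTime_le {w : ℕ → ℝ × ℝ} (hw : w ∈ goodNoise) (t : ℝ) :
    {n : ℕ | refreshTime w (n + 1) ≤ t}.Finite := by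
  obtain ⟨N, hN⟩ := hw.2 t
  refine (Set.finite_Iio N).subset fun n (hn : refreshTime w (n + 1) ≤ t) => ?_
  by_contra h
  have := monotone_refreshTime hw (show N ≤ n + 1 by simp at h; omega)
  linarith

theorem refreshCount_of_lt {w : ℕ → ℝ × ℝ} (hw : w ∈ goodNoise) {t : ℝ} (ht : t < (w 0).1) :
    refreshCount w t = 0 := by
  have : {n : ℕ | refreshTime w (n + 1) ≤ t} = ∅ := by
    ext n
    have := monotone_refreshTime hw (show 1 ≤ n + 1 by omega)
    have h1 : refreshTime w 1 = (w 0).1 := by simp [refreshTime]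
    simp
    linarith
  rw [refreshCount, this, Set.ncard_empty]

theorem refreshCount_of_le {w : ℕ → ℝ × ℝ} (hw : w ∈ goodNoise) {t : ℝ} (ht : (w 0).1 ≤ t) :
    refreshCount w t = refreshCount (shiftSeq w) (t - (w 0).1) + 1 := by
  have : {n : ℕ | refreshTime w (n + 1) ≤ t} =
      insert 0 (Nat.succ '' {n : ℕ | refreshTime (shiftSeq w) (n + 1) ≤ t - (w 0).1}) := by
    ext n
    cases n with
    | zero => simpa [refreshTime] using ht
    | succ n =>
      have := refreshTime_succ w (n + 1)
      simp only [Set.mem_ofPred_eq, Set.mem_insert_iff, Nat.succ_ne_zero, false_or, Set.mem_image,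
        Nat.succ_eq_add_one, Nat.add_right_cancel_iff, exists_eq_right]
      rw [this]
      constructor <;> intro h <;> linarith
  rw [refreshCount, this, Set.ncard_insert_of_notMem (by simp)
    ((finite_refreshTime_le (shiftSeq_mem_goodNoise hw) _).image _),
    Set.ncard_image_of_injective _ Nat.succ_injective, refreshCount]

variable {U : ℝ → ℝ} {α : ℝ}

theorem refreshState_succ_shift (w : ℕ → ℝ × ℝ) (z : Phase) (n : ℕ) :
    refreshState U α w z (n + 1) = refreshState U α (shiftSeq w)
      (refresh α (hamiltonianFlow U (w 0).1 z) (w 0).2) n := by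
  induction n with
  | zero => rfl
  | succ n ih => rw [refreshState, ih]; rfl

theorem rhmc_of_lt {w : ℕ → ℝ × ℝ} (hw : w ∈ goodNoise) {t : ℝ} (ht : t < (w 0).1) (z : Phase) :
    rhmc U α t w z = hamiltonianFlow U t z := by
  rw [rhmc, refreshCount_of_lt hw ht]
  simp [refreshTime, refreshState]

/-- With `rhmc_of_lt` this is the pathwise renewal equation: the process restarts after the first
refreshment, driven by the shifted noise. -/
theorem rhmc_of_le {w : ℕ → ℝ × ℝ} (hw : w ∈ goodNoise) {t : ℝ} (ht : (w 0).1 ≤ t) (z : Phase) :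
    rhmc U α t w z = rhmc U α (t - (w 0).1) (shiftSeq w)
      (refresh α (hamiltonianFlow U (w 0).1 z) (w 0).2) := by
  rw [rhmc, rhmc, refreshCount_of_le hw ht, refreshTime_succ, refreshState_succ_shift]
  congr 1
  ring

theorem measurable_refreshTime (n : ℕ) : Measurable fun w : ℕ → ℝ × ℝ => refreshTime w n := by
  unfold refreshTime
  fun_prop

theorem measurable_refreshCount (t : ℝ) : Measurable fun w : ℕ → ℝ × ℝ => refreshCount w t := by
  refine measurable_ncard.comp (measurable_set_iff.2 fun n => ?_)
  exact measurableSet_setOfPred.1 (measurableSet_le (measurable_refreshTime (n + 1)) measurable_const)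

theorem measurable_refresh (α : ℝ) : Measurable fun p : Phase × ℝ => refresh α p.1 p.2 := by
  unfold refresh
  fun_prop

theorem measurable_refreshState (hU : IsContinuousFlow U) (α : ℝ) (n : ℕ) :
    Measurable fun p : (ℕ → ℝ × ℝ) × Phase => refreshState U α p.1 p.2 n := by
  induction n with
  | zero => exact measurable_snd
  | succ n ih =>
    have h1 : Measurable fun p : (ℕ → ℝ × ℝ) × Phase => p.1 n :=
      (measurable_pi_apply n).comp measurable_fst
    exact (measurable_refresh α).comp
      ((hU.continuous.measurable.comp (h1.fst.prodMk ih)).prodMk h1.snd)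

theorem measurable_rhmc (hU : IsContinuousFlow U) (α t : ℝ) :
    Measurable fun p : (ℕ → ℝ × ℝ) × Phase => rhmc U α t p.1 p.2 := by
  have h1 : Measurable fun q : ((ℕ → ℝ × ℝ) × Phase) × ℕ =>
      hamiltonianFlow U (t - refreshTime q.1.1 q.2) (refreshState U α q.1.1 q.1.2 q.2) :=
    measurable_from_prod_countable_left fun n => hU.continuous.measurable.comp
      ((measurable_const.sub ((measurable_refreshTime n).comp measurable_fst)).prodMk
        (measurable_refreshState hU α n))
  exact h1.comp (measurable_id.prodMk ((measurable_refreshCount t).comp measurable_fst))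

/-- Bounded refreshment times would make the waiting times summable, hence convergent to 0. But
almost surely infinitely many exceed 1, because k successive ones are all at most 1 with probability
pᵏ for some p < 1. -/
theorem ae_mem_goodNoise {lam : ℝ} (hlam : 0 < lam) : ∀ᵐ w ∂noiseLaw lam, w ∈ goodNoise := by
  have := isProbabilityMeasure_expMeasure hlam
  have hp := isProbabilityMeasure_stepLaw hlam
  have h0 : ∀ᵐ w ∂noiseLaw lam, ∀ n, 0 < (w n).1 := by
    refine ae_all_iff.2 fun n => ?_
    exact (measurePreserving_eval_infinitePi (fun _ : ℕ => stepLaw lam) n).quasiMeasurePreserving.ae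
      (ae_stepLaw_pos hlam)
  have hlt : stepLaw lam {a | a.1 ≤ 1} < 1 := by
    have h1 : {a : ℝ × ℝ | a.1 ≤ 1} = Set.Iic 1 ×ˢ Set.univ := by ext; simp
    rw [h1, stepLaw, Measure.prod_prod, measure_univ, mul_one, ← ofReal_measureReal,
      expMeasure_real_Iic hlam zero_le_one, ENNReal.ofReal_lt_one]
    linarith [Real.exp_pos (-(lam * 1))]
  have h1 : ∀ᵐ w ∂noiseLaw lam, ∀ m, ∃ n ≥ m, 1 < (w n).1 := by
    refine ae_all_iff.2 fun m => ?_
    rw [ae_iff]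
    refine le_antisymm (ge_of_tendsto (ENNReal.tendsto_pow_atTop_nhds_zero_of_lt_one hlt)
      (Eventually.of_forall fun k => ?_)) bot_le
    have h2 : {w : ℕ → ℝ × ℝ | ¬∃ n ≥ m, 1 < (w n).1} ⊆
        Set.pi (Finset.Ico m (m + k)) fun _ => {a : ℝ × ℝ | a.1 ≤ 1} := by
      intro w hw i hi
      simp only [Set.mem_ofPred_eq, not_exists, not_and, not_lt] at hw
      exact hw i (Finset.mem_Ico.1 hi).1
    refine (measure_mono h2).trans (le_of_eq ?_)
    rw [noiseLaw]
    erw [Measure.infinitePi_pi (fun _ : ℕ => stepLaw lam) fun i _ =>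
      measurableSet_le measurable_fst measurable_const]
    simp
  filter_upwards [h0, h1] with w hw0 hw1
  refine ⟨hw0, fun t => ?_⟩
  by_contra! hcon
  have hs : Summable fun n => (w n).1 :=
    summable_of_sum_range_le (fun n => (hw0 n).le) hcon
  obtain ⟨m, hm⟩ := eventually_atTop.1 (hs.tendsto_atTop_zero.eventually (gt_mem_nhds one_pos))
  obtain ⟨n, hn, hn1⟩ := hw1 m
  exact absurd (hm n hn) (not_lt.2 hn1.le)

end Renewal

/-! ### Replacing the noise after a deterministic time. -/

section Splice

/-- The noise `w` up to time `s`, followed by the noise `w'`. -/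
noncomputable def splice : ℝ → (ℕ → ℝ × ℝ) → (ℕ → ℝ × ℝ) → ℕ → ℝ × ℝ
  -- In the recursion s is the time left since the last refreshment. The waiting time straddling s
  -- is replaced by s plus the first waiting time of w', with the Gaussian of w'.
  | s, w, w', 0 => if s < (w 0).1 then (s + (w' 0).1, (w' 0).2) else w 0
  | s, w, w', n + 1 =>
    if s < (w 0).1 then w' (n + 1) else splice (s - (w 0).1) (shiftSeq w) w' n

theorem splice_of_lt {s : ℝ} {w : ℕ → ℝ × ℝ} (hs : s < (w 0).1) (w' : ℕ → ℝ × ℝ) :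
    splice s w w' = consSeq (s + (w' 0).1, (w' 0).2) (shiftSeq w') := by
  ext n : 1
  cases n <;> simp [splice, hs, shiftSeq]

theorem splice_of_le {s : ℝ} {w : ℕ → ℝ × ℝ} (hs : (w 0).1 ≤ s) (w' : ℕ → ℝ × ℝ) :
    splice s w w' = consSeq (w 0) (splice (s - (w 0).1) (shiftSeq w) w') := by
  ext n : 1
  cases n <;> simp [splice, not_lt.2 hs]

theorem measurable_splice :
    Measurable fun q : ℝ × (ℕ → ℝ × ℝ) × (ℕ → ℝ × ℝ) => splice q.1 q.2.1 q.2.2 := by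
  refine measurable_pi_iff.2 fun n => ?_
  induction n with
  | zero =>
    simp only [splice]
    refine Measurable.ite (measurableSet_lt (by fun_prop) (by fun_prop)) (by fun_prop) (by fun_prop)
  | succ n ih =>
    simp only [splice]
    refine Measurable.ite (measurableSet_lt (by fun_prop) (by fun_prop)) (by fun_prop) ?_
    have h : Measurable fun q : ℝ × (ℕ → ℝ × ℝ) × (ℕ → ℝ × ℝ) =>
        (q.1 - (q.2.1 0).1, shiftSeq q.2.1, q.2.2) := by
      refine Measurable.prodMk (by fun_prop) (Measurable.prodMk ?_ (by fun_prop))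
      exact measurable_shiftSeq.comp (by fun_prop)
    exact ih.comp h

theorem noiseLaw_eq (lam : ℝ) : noiseLaw lam = Measure.infinitePi fun _ : ℕ => stepLaw lam := rfl

theorem measurableSet_initial {B : ℕ → Set (ℝ × ℝ)} (hB : ∀ i, MeasurableSet (B i)) (n : ℕ) :
    MeasurableSet {w : ℕ → ℝ × ℝ | ∀ i < n, w i ∈ B i} := by
  simp only [Set.ofPred_forall]
  exact .iInter fun i => .iInter fun _ => measurable_pi_apply i (hB i)

/-- Split according to whether the first waiting time exceeds s. If so, lack of memory shows that
the new first step has the law of a step conditioned on exceeding s. If not, the first step is kept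
and the induction hypothesis applies to the remaining time. The two contributions recombine into the
law of the first step on `B 0`; since the remaining time is random, the induction is over all s. -/
theorem noiseLaw_splice_initial {lam : ℝ} (hlam : 0 < lam) (n : ℕ) :
    ∀ (B : ℕ → Set (ℝ × ℝ)), (∀ i, MeasurableSet (B i)) → ∀ s : ℝ, 0 ≤ s →
      (noiseLaw lam).prod (noiseLaw lam) {p | ∀ i < n, splice s p.1 p.2 i ∈ B i} =
        ∏ i ∈ Finset.range n, stepLaw lam (B i) := by
  have := isProbabilityMeasure_noiseLaw hlam
  have := isProbabilityMeasure_stepLaw hlam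
  induction n with
  | zero => intro B hB s hs; simp
  | succ n ih =>
    intro B hB s hs
    set μ := noiseLaw lam with hμ
    have hcons : MeasurePreserving (fun p : (ℝ × ℝ) × (ℕ → ℝ × ℝ) => consSeq p.1 p.2)
      ((stepLaw lam).prod μ) μ := measurePreserving_consSeq (stepLaw lam)
    set B' : ℕ → Set (ℝ × ℝ) := fun i => B (i + 1) with hB'
    have hmB' : ∀ i, MeasurableSet (B' i) := fun i => hB (i + 1)
    set A₁ : Set ((ℕ → ℝ × ℝ) × (ℕ → ℝ × ℝ)) := {w | s < (w 0).1} ×ˢ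
      {w | ∀ i < n + 1, consSeq (s + (w 0).1, (w 0).2) (shiftSeq w) i ∈ B i} with hA₁
    set A₂ : Set ((ℕ → ℝ × ℝ) × (ℕ → ℝ × ℝ)) := {p | (p.1 0 ∈ B 0 ∧ (p.1 0).1 ≤ s) ∧
      ∀ i < n, splice (s - (p.1 0).1) (shiftSeq p.1) p.2 i ∈ B' i} with hA₂
    have hunion : {p : (ℕ → ℝ × ℝ) × (ℕ → ℝ × ℝ) | ∀ i < n + 1, splice s p.1 p.2 i ∈ B i} =
        A₁ ∪ A₂ := by
      ext p
      simp only [hA₁, hA₂, Set.mem_ofPred_eq, Set.mem_union, Set.mem_prod]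
      rcases lt_or_ge s (p.1 0).1 with h | h
      · rw [splice_of_lt h]
        simp [h, not_le.2 h]
      · rw [splice_of_le h, forall_lt_succ_consSeq]
        simp [h, not_lt.2 h, hB']
    have hdisj : Disjoint A₁ A₂ := by
      refine Set.disjoint_left.2 fun p h1 h2 => ?_
      have h3 : s < (p.1 0).1 := h1.1
      have h4 : (p.1 0).1 ≤ s := h2.1.2
      linarith
    have hmS : MeasurableSet {q : (ℝ × ℝ) × (ℕ → ℝ × ℝ) × (ℕ → ℝ × ℝ) |
        ∀ i < n, splice (s - q.1.1) q.2.1 q.2.2 i ∈ B' i} := by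
      have : Measurable fun q : (ℝ × ℝ) × (ℕ → ℝ × ℝ) × (ℕ → ℝ × ℝ) =>
          splice (s - q.1.1) q.2.1 q.2.2 := by
        have h : Measurable fun q : (ℝ × ℝ) × (ℕ → ℝ × ℝ) × (ℕ → ℝ × ℝ) =>
          (s - q.1.1, q.2.1, q.2.2) := by fun_prop
        exact measurable_splice.comp h
      exact this (measurableSet_initial hmB' n)
    have hm₂ : MeasurableSet A₂ := by
      have h : Measurable fun p : (ℕ → ℝ × ℝ) × (ℕ → ℝ × ℝ) => (p.1 0, shiftSeq p.1, p.2) :=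
        Measurable.prodMk (by fun_prop) ((measurable_shiftSeq.comp measurable_fst).prodMk
          measurable_snd)
      have h1 : MeasurableSet {p : (ℕ → ℝ × ℝ) × (ℕ → ℝ × ℝ) | p.1 0 ∈ B 0 ∧ (p.1 0).1 ≤ s} := by
        have h2 : MeasurableSet (B 0 ∩ {a : ℝ × ℝ | a.1 ≤ s}) :=
          (hB 0).inter (measurableSet_le measurable_fst measurable_const)
        exact (show Measurable fun p : (ℕ → ℝ × ℝ) × (ℕ → ℝ × ℝ) => p.1 0 by fun_prop) h2
      exact h1.inter (h hmS)
    have hs1 : MeasurableSet {a : ℝ × ℝ | s < a.1} := measurableSet_lt measurable_const measurable_fst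
    have e₁ : μ.prod μ A₁ = stepLaw lam (B 0 ∩ {a | s < a.1}) *
        ∏ i ∈ Finset.range n, stepLaw lam (B' i) := by
      have h1 : μ {w | s < (w 0).1} = stepLaw lam {a | s < a.1} :=
        (measurePreserving_eval_infinitePi (fun _ : ℕ => stepLaw lam) 0).measure_preimage
          hs1.nullMeasurableSet
      have h2 : μ {w | ∀ i < n + 1, consSeq (s + (w 0).1, (w 0).2) (shiftSeq w) i ∈ B i} =
          stepLaw lam {a | (s + a.1, a.2) ∈ B 0} * ∏ i ∈ Finset.range n, stepLaw lam (B' i) := by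
        have hm : MeasurableSet {a : ℝ × ℝ | (s + a.1, a.2) ∈ B 0} :=
          (show Measurable fun a : ℝ × ℝ => (s + a.1, a.2) by fun_prop) (hB 0)
        have h3 := infinitePi_initial (stepLaw lam) (n + 1)
          (B := consSeq {a : ℝ × ℝ | (s + a.1, a.2) ∈ B 0} B')
          (fun i => by cases i; exacts [hm, hmB' _])
        rw [Finset.prod_range_succ', mul_comm] at h3
        rw [hμ, noiseLaw_eq]
        refine (congrArg _ ?_).trans h3
        ext w
        simp only [Set.mem_ofPred_eq, forall_lt_succ_consSeq]
        exact (Nat.forall_lt_succ_left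
          (p := fun i => w i ∈ consSeq {a : ℝ × ℝ | (s + a.1, a.2) ∈ B 0} B' i)).symm
      rw [hA₁, Measure.prod_prod, h1, h2, ← mul_assoc, stepLaw_memoryless hlam hs (hB 0)]
    have e₂ : μ.prod μ A₂ = stepLaw lam (B 0 ∩ {a | s < a.1}ᶜ) *
        ∏ i ∈ Finset.range n, stepLaw lam (B' i) := by
      -- The first noise is written as its first step followed by an independent noise, so that the
      -- induction hypothesis can be applied for each fixed first step.
      have hmp := (hcons.prod (MeasurePreserving.id μ)).comp
        (measurePreserving_prodAssoc (stepLaw lam) μ μ).symm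
      rw [← hmp.measure_preimage hm₂.nullMeasurableSet, Measure.prod_apply (hmp.measurable hm₂)]
      have h1 : ∀ a : ℝ × ℝ, μ.prod μ (Prod.mk a ⁻¹' ((Prod.map
          (fun p : (ℝ × ℝ) × (ℕ → ℝ × ℝ) => consSeq p.1 p.2) id ∘
            MeasurableEquiv.prodAssoc.symm) ⁻¹' A₂)) =
          (B 0 ∩ {a | s < a.1}ᶜ).indicator
            (fun _ => ∏ i ∈ Finset.range n, stepLaw lam (B' i)) a := by
        intro a
        by_cases ha : a ∈ B 0 ∩ {a | s < a.1}ᶜ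
        · have ha2 : a.1 ≤ s := not_lt.1 ha.2
          rw [Set.indicator_of_mem ha, ← ih B' hmB' (s - a.1) (by linarith)]
          congr 1
          ext p
          exact ⟨fun h => h.2, fun h => ⟨⟨ha.1, ha2⟩, h⟩⟩
        · rw [Set.indicator_of_notMem ha]
          convert measure_empty (μ := μ.prod μ)
          ext p
          refine ⟨fun h => ha ⟨h.1.1, not_lt.2 h.1.2⟩, fun h => h.elim⟩
      rw [lintegral_congr h1, lintegral_indicator_const ((hB 0).inter hs1.compl), mul_comm]
    rw [hunion, measure_union hdisj hm₂, e₁, e₂, ← add_mul, Finset.prod_range_succ', mul_comm]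
    congr 1
    rw [← measure_inter_add_sdiff (B 0) hs1]
    rfl

theorem measurePreserving_splice {lam : ℝ} (hlam : 0 < lam) {s : ℝ} (hs : 0 ≤ s) :
    MeasurePreserving (fun p : (ℕ → ℝ × ℝ) × (ℕ → ℝ × ℝ) => splice s p.1 p.2)
      ((noiseLaw lam).prod (noiseLaw lam)) (noiseLaw lam) := by
  have := isProbabilityMeasure_stepLaw hlam
  have hm : Measurable fun p : (ℕ → ℝ × ℝ) × (ℕ → ℝ × ℝ) => splice s p.1 p.2 :=
    measurable_splice.comp (Measurable.prodMk measurable_const measurable_id)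
  refine ⟨hm, ?_⟩
  rw [noiseLaw_eq lam]
  refine eq_infinitePi_of_initial _ fun n B hB => ?_
  rw [Measure.map_apply hm (measurableSet_initial hB n)]
  exact noiseLaw_splice_initial hlam n B hB s hs

variable {U : ℝ → ℝ}

/-- Induction on a number n of refreshments with s < Tₙ: steps completed before s are common to both
noises and are removed by the renewal equation. When s falls within the first interval, only the
group property of the flow is needed. -/
theorem rhmc_splice (hU : IsContinuousFlow U) (α : ℝ) {s : ℝ} (hs : 0 ≤ s)
    {w w' : ℕ → ℝ × ℝ} (hw : w ∈ goodNoise) (hw' : w' ∈ goodNoise)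
    (hsp : splice s w w' ∈ goodNoise) (z : Phase) :
    (∀ u ≤ s, rhmc U α u (splice s w w') z = rhmc U α u w z) ∧
      ∀ t, 0 ≤ t → rhmc U α (s + t) (splice s w w') z = rhmc U α t w' (rhmc U α s w z) := by
  obtain ⟨n, hn⟩ := hw.2 s
  induction n generalizing s w z with
  | zero => simp [refreshTime] at hn; linarith
  | succ n ih =>
    rcases lt_or_ge s (w 0).1 with h | h
    · have e := splice_of_lt h w'
      have e0 : (splice s w w' 0).1 = s + (w' 0).1 := by rw [e]; rfl
      have e0' : (splice s w w' 0).2 = (w' 0).2 := by rw [e]; rfl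
      have e1 : shiftSeq (splice s w w') = shiftSeq w' := by rw [e]; rfl
      have hpos := hw'.1 0
      refine ⟨fun u hu => ?_, fun t ht => ?_⟩
      · rw [rhmc_of_lt hsp (by rw [e0]; linarith), rhmc_of_lt hw (by linarith)]
      · rw [rhmc_of_lt hw h]
        rcases lt_or_ge t (w' 0).1 with h1 | h1
        · rw [rhmc_of_lt hsp (by rw [e0]; linarith), rhmc_of_lt hw' h1, hU.add]
        · rw [rhmc_of_le hsp (by rw [e0]; linarith), rhmc_of_le hw' h1, e0, e0', e1, hU.add,
            add_sub_add_left_eq_sub]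
    · have e := splice_of_le h w'
      have e0 : splice s w w' 0 = w 0 := by rw [e]; rfl
      have e1 : shiftSeq (splice s w w') = splice (s - (w 0).1) (shiftSeq w) w' := by rw [e]; rfl
      have hsp' := shiftSeq_mem_goodNoise hsp
      rw [e1] at hsp'
      have hn' : s - (w 0).1 < refreshTime (shiftSeq w) n := by
        rw [refreshTime_succ] at hn
        linarith
      have key := fun z => ih (s := s - (w 0).1) (by linarith) (shiftSeq_mem_goodNoise hw) hsp' z hn'
      have hpos := hw.1 0
      refine ⟨fun u hu => ?_, fun t ht => ?_⟩
      · rcases lt_or_ge u (w 0).1 with h1 | h1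
        · rw [rhmc_of_lt hsp (by rwa [e0]), rhmc_of_lt hw h1]
        · rw [rhmc_of_le hsp (by rwa [e0]), rhmc_of_le hw h1, e0, e1, (key _).1 _ (by linarith)]
      · rw [rhmc_of_le hsp (by rw [e0]; linarith), rhmc_of_le hw h, e0, e1, ← (key _).2 t ht]
        congr 1
        ring

end Splice

/-! ### The Markov property. -/

section Markov

variable {U : ℝ → ℝ}

theorem abs_transition_le {Ω : Type*} [MeasurableSpace Ω] {μ : Measure Ω} [IsProbabilityMeasure μ]
    {Z : ℝ → Ω → Phase → Phase} {f : Phase → ℝ} {C : ℝ} (hC : ∀ z, |f z| ≤ C) (t : ℝ) (z : Phase) :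
    |transition μ Z t f z| ≤ C := by
  have := norm_integral_le_of_norm_le_const (μ := μ) (f := fun w => f (Z t w z))
    (Eventually.of_forall fun w => hC _)
  simpa [transition] using this

theorem measurable_rhmc_swap (hU : IsContinuousFlow U) (α t : ℝ) :
    Measurable fun p : Phase × (ℕ → ℝ × ℝ) => rhmc U α t p.2 p.1 := by
  have h : Measurable (Prod.swap : Phase × (ℕ → ℝ × ℝ) → (ℕ → ℝ × ℝ) × Phase) := measurable_swap
  have h1 := (measurable_rhmc hU α t).comp h
  simpa only [Function.comp_def, Prod.fst_swap, Prod.snd_swap] using h1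

theorem measurable_rhmc_noise (hU : IsContinuousFlow U) (α t : ℝ) (z : Phase) :
    Measurable fun w : ℕ → ℝ × ℝ => rhmc U α t w z := by
  have h : Measurable fun w : ℕ → ℝ × ℝ => (w, z) := measurable_prodMk_right
  have h1 := (measurable_rhmc hU α t).comp h
  simpa only [Function.comp_def] using h1

theorem measurable_transition_rhmc {lam : ℝ} (hlam : 0 < lam) (hU : IsContinuousFlow U) (α t : ℝ)
    {f : Phase → ℝ} (hf : Measurable f) :
    Measurable (transition (noiseLaw lam) (rhmc U α) t f) := by
  have := isProbabilityMeasure_noiseLaw hlam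
  have h : StronglyMeasurable fun p : Phase × (ℕ → ℝ × ℝ) => f (rhmc U α t p.2 p.1) :=
    (hf.comp (measurable_rhmc_swap hU α t)).stronglyMeasurable
  exact (StronglyMeasurable.integral_prod_right' (ν := noiseLaw lam) h).measurable

theorem pastSigma_mono {Ω : Type*} {m : MeasurableSpace Ω} {Z : ℝ → Ω → Phase}
    (hZ : ∀ t, 0 ≤ t → Measurable (Z t)) (s : ℝ) : pastSigma Z s ≤ m :=
  iSup₂_le fun u hu => (hZ u hu.1).comap_le

/-- Events of the past up to time `s` do not depend on the noise after time `s`. -/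
theorem mem_past_splice_iff (hU : IsContinuousFlow U) (α : ℝ) {s : ℝ} (hs : 0 ≤ s)
    {A : Set (Phase × (ℕ → ℝ × ℝ))}
    (hA : MeasurableSet[pastSigma (fun t p => rhmc U α t p.2 p.1) s] A) {z : Phase}
    {w w' : ℕ → ℝ × ℝ} (hw : w ∈ goodNoise) (hw' : w' ∈ goodNoise)
    (hsp : splice s w w' ∈ goodNoise) : (z, splice s w w') ∈ A ↔ (z, w) ∈ A := by
  -- The sets insensitive to the splicing form a σ-algebra, so it is enough to test the generating
  -- events.
  let m : MeasurableSpace (Phase × (ℕ → ℝ × ℝ)) :=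
    { MeasurableSet' := fun A => (z, splice s w w') ∈ A ↔ (z, w) ∈ A
      measurableSet_empty := Iff.rfl
      measurableSet_compl := fun A h => not_congr h
      measurableSet_iUnion := fun A h => by simpa using exists_congr h }
  have hm : pastSigma (fun t (p : Phase × (ℕ → ℝ × ℝ)) => rhmc U α t p.2 p.1) s ≤ m := by
    refine iSup₂_le fun u hu => ?_
    rintro _ ⟨B, -, rfl⟩
    change rhmc U α u (splice s w w') z ∈ B ↔ rhmc U α u w z ∈ B
    rw [(rhmc_splice hU α hs hw hw' hsp z).1 u hu.2]
  exact hm A hA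

/-- Splicing in an independent noise after s leaves the joint law unchanged, fixes every past event
A, and turns the value at s + t into that of an independent process restarted from the state at s.
Fubini then gives the integrals over A that characterize the conditional expectation. -/
theorem isMarkovProcess_rhmc {lam : ℝ} (hlam : 0 < lam) (hU : IsContinuousFlow U) (α : ℝ)
    (ν : Measure Phase) [IsProbabilityMeasure ν] :
    IsMarkovProcess (ν.prod (noiseLaw lam)) (fun t p => rhmc U α t p.2 p.1)
      (transition (noiseLaw lam) (rhmc U α)) := by
  have := isProbabilityMeasure_noiseLaw hlam
  set μ := noiseLaw lam with hμ
  refine ⟨fun t _ => measurable_rhmc_swap hU α t, ?_⟩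
  rintro s t hs ht f hf ⟨C, hC⟩
  have hm : pastSigma (fun t (p : Phase × (ℕ → ℝ × ℝ)) => rhmc U α t p.2 p.1) s ≤
      Prod.instMeasurableSpace :=
    pastSigma_mono (fun t _ => measurable_rhmc_swap hU α t) s
  have hPm : Measurable (transition μ (rhmc U α) t f) := measurable_transition_rhmc hlam hU α t hf
  have hint : ∀ {g : Phase → ℝ}, Measurable g → (∀ z, |g z| ≤ C) → ∀ u,
      Integrable (fun p : Phase × (ℕ → ℝ × ℝ) => g (rhmc U α u p.2 p.1)) (ν.prod μ) :=
    fun hg hgC u => Integrable.of_bound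
      (hg.comp (measurable_rhmc_swap hU α u)).aestronglyMeasurable C
      (Eventually.of_forall fun p => hgC _)
  symm
  refine ae_eq_condExp_of_forall_setIntegral_eq hm (hint hf hC (s + t))
    (fun A _ _ => (hint hPm (abs_transition_le hC t) s).integrableOn) (fun A hA _ => ?_) ?_
  · have hA' := hm A hA
    set Φ : (Phase × (ℕ → ℝ × ℝ)) × (ℕ → ℝ × ℝ) → Phase × (ℕ → ℝ × ℝ) :=
      fun q => (q.1.1, splice s q.1.2 q.2) with hΦ
    have hΦm : MeasurePreserving Φ ((ν.prod μ).prod μ) (ν.prod μ) :=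
      ((MeasurePreserving.id ν).prod (measurePreserving_splice hlam hs)).comp
        (measurePreserving_prodAssoc ν μ μ)
    have hgood : ∀ᵐ q ∂(ν.prod μ).prod μ, q.1.2 ∈ goodNoise ∧ q.2 ∈ goodNoise ∧
        splice s q.1.2 q.2 ∈ goodNoise := by
      have h1 : ∀ᵐ p ∂ν.prod μ, p.2 ∈ goodNoise :=
        Measure.quasiMeasurePreserving_snd.ae (ae_mem_goodNoise hlam)
      have h2 : ∀ᵐ q ∂(ν.prod μ).prod μ, q.1.2 ∈ goodNoise :=
        Measure.quasiMeasurePreserving_fst.ae h1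
      have h3 : ∀ᵐ q ∂(ν.prod μ).prod μ, q.2 ∈ goodNoise :=
        Measure.quasiMeasurePreserving_snd.ae (ae_mem_goodNoise hlam)
      have h4 : ∀ᵐ q ∂(ν.prod μ).prod μ, (Φ q).2 ∈ goodNoise := hΦm.quasiMeasurePreserving.ae h1
      filter_upwards [h2, h3, h4] with q a b c using ⟨a, b, c⟩
    set F : Phase × (ℕ → ℝ × ℝ) → ℝ := A.indicator fun p => f (rhmc U α (s + t) p.2 p.1) with hF
    set H : (Phase × (ℕ → ℝ × ℝ)) × (ℕ → ℝ × ℝ) → ℝ := fun q =>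
      A.indicator (fun p => f (rhmc U α t q.2 (rhmc U α s p.2 p.1))) q.1 with hH
    have hFint : Integrable F (ν.prod μ) := (hint hf hC (s + t)).indicator hA'
    have hFH : ∀ᵐ q ∂(ν.prod μ).prod μ, F (Φ q) = H q := by
      filter_upwards [hgood] with q hq
      have h1 := mem_past_splice_iff hU α hs hA (z := q.1.1) hq.1 hq.2.1 hq.2.2
      have h2 := (rhmc_splice hU α hs hq.1 hq.2.1 hq.2.2 q.1.1).2 t ht
      by_cases hqA : q.1 ∈ A
      · have h3 : Φ q ∈ A := h1.2 hqA
        simp only [hF, hH, Set.indicator_of_mem h3, Set.indicator_of_mem hqA]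
        rw [← h2]
      · have h3 : Φ q ∉ A := fun h => hqA (h1.1 h)
        simp only [hF, hH, Set.indicator_of_notMem h3, Set.indicator_of_notMem hqA]
    have hFΦ : Integrable (fun q => F (Φ q)) ((ν.prod μ).prod μ) := hΦm.integrable_comp_of_integrable hFint
    have hHint : Integrable H ((ν.prod μ).prod μ) := hFΦ.congr hFH
    calc ∫ p in A, transition μ (rhmc U α) t f (rhmc U α s p.2 p.1) ∂ν.prod μ
        = ∫ p, ∫ w', H (p, w') ∂μ ∂ν.prod μ := by
          rw [← integral_indicator hA']
          congr 1
          ext p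
          by_cases hp : p ∈ A
          · simp only [hH, Set.indicator_of_mem hp, transition]
          · simp only [hH, Set.indicator_of_notMem hp, integral_zero]
      _ = ∫ q, H q ∂(ν.prod μ).prod μ := (integral_prod _ hHint).symm
      _ = ∫ q, F (Φ q) ∂(ν.prod μ).prod μ := integral_congr_ae (hFH.mono fun q h => h.symm)
      _ = ∫ p, F p ∂ν.prod μ := by
          have h := integral_map (μ := (ν.prod μ).prod μ) hΦm.measurable.aemeasurable
            (f := F) (by rw [hΦm.map_eq]; exact hFint.aestronglyMeasurable)
          rw [hΦm.map_eq] at h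
          exact h.symm
      _ = ∫ p in A, f (rhmc U α (s + t) p.2 p.1) ∂ν.prod μ := integral_indicator hA'
  · refine StronglyMeasurable.aestronglyMeasurable ?_
    refine (hPm.comp ?_).stronglyMeasurable
    exact (comap_measurable _).mono (le_iSup₂_of_le s ⟨hs, le_rfl⟩ le_rfl) le_rfl

end Markov

/-! ### Preservation of C₀ and strong continuity of the flow. -/

section Averages

/-- Averaging a function of `C₀` over random homeomorphisms gives a function of `C₀`. -/
theorem exists_zeroAtInfty_average {Ω : Type*} [MeasurableSpace Ω] (μ : Measure Ω)
    [IsProbabilityMeasure μ] {H : Ω → Phase → Phase} (hH : ∀ w, IsHomeomorph (H w))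
    (hm : ∀ z, Measurable fun w => H w z) (f : C₀(Phase, ℝ)) :
    ∃ g : C₀(Phase, ℝ), ∀ z, g z = ∫ w, f (H w z) ∂μ := by
  have hb : ∀ z, ‖f z‖ ≤ ‖f.toBCF‖ := fun z => f.toBCF.norm_coe_le_norm z
  have hfm : ∀ z, AEStronglyMeasurable (fun w => f (H w z)) μ := fun z =>
    (f.continuous.measurable.comp (hm z)).aestronglyMeasurable
  refine ⟨⟨⟨fun z => ∫ w, f (H w z) ∂μ, ?_⟩, ?_⟩, fun z => rfl⟩
  · exact continuous_of_dominated hfm (fun z => Eventually.of_forall fun w => hb _)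
      (integrable_const ‖f.toBCF‖)
      (Eventually.of_forall fun w => f.continuous.comp (hH w).continuous)
  · have : (cocompact Phase).IsCountablyGenerated := by
      rw [← Metric.cobounded_eq_cocompact, ← comap_norm_atTop]
      infer_instance
    have h := tendsto_integral_filter_of_dominated_convergence (μ := μ)
      (l := cocompact Phase) (F := fun z w => f (H w z)) (f := fun _ => 0) (fun _ => ‖f.toBCF‖)
      (Eventually.of_forall hfm) (Eventually.of_forall fun z => Eventually.of_forall fun w => hb _)
      (integrable_const _) (Eventually.of_forall fun w =>
        f.zero_at_infty'.comp (hH w).isClosedEmbedding.tendsto_cocompact)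
    simpa using h

/-- Here α ≠ 0 is essential: for α = 0 the old velocity is forgotten, and states with large velocity
are not sent to infinity. -/
theorem isHomeomorph_refresh {α : ℝ} (hα : α ≠ 0) (ξ : ℝ) :
    IsHomeomorph fun z => refresh α z ξ :=
  (Homeomorph.mk ⟨fun z => refresh α z ξ, fun z => (z.1, α⁻¹ * (z.2 - √(1 - α ^ 2) * ξ)),
    fun z => by simp [refresh, hα], fun z => by simp [refresh, hα]⟩
    (by simp only [refresh]; fun_prop) (by fun_prop)).isHomeomorph

variable {U : ℝ → ℝ}

theorem IsContinuousFlow.isHomeomorph (hU : IsContinuousFlow U) (t : ℝ) :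
    IsHomeomorph (hamiltonianFlow U t) :=
  (Homeomorph.mk ⟨hamiltonianFlow U t, hamiltonianFlow U (-t),
    fun z => by rw [← hU.add, add_neg_cancel, hU.zero],
    fun z => by rw [← hU.add, neg_add_cancel, hU.zero]⟩
    (hU.continuous_time t) (hU.continuous_time (-t))).isHomeomorph

/-- For fixed noise the state is a finite composition of flow maps and refreshments. This is true
for every noise, so preservation of C₀ needs no growth estimate. -/
theorem isHomeomorph_rhmc (hU : IsContinuousFlow U) {α : ℝ} (hα : α ≠ 0) (t : ℝ)
    (w : ℕ → ℝ × ℝ) : IsHomeomorph (rhmc U α t w) := by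
  have h : ∀ n, IsHomeomorph fun z => refreshState U α w z n := by
    intro n
    induction n with
    | zero => exact (Homeomorph.refl Phase).isHomeomorph
    | succ n ih =>
      exact (isHomeomorph_refresh hα (w n).2).comp ((hU.isHomeomorph (w n).1).comp ih)
  exact (hU.isHomeomorph _).comp (h _)

theorem exists_zeroAtInfty_transition {lam : ℝ} (hlam : 0 < lam) (hU : IsContinuousFlow U) {α : ℝ}
    (hα : α ≠ 0) (t : ℝ) (f : C₀(Phase, ℝ)) :
    ∃ g : C₀(Phase, ℝ), ∀ z, g z = transition (noiseLaw lam) (rhmc U α) t f z := by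
  have := isProbabilityMeasure_noiseLaw hlam
  exact exists_zeroAtInfty_average (noiseLaw lam) (isHomeomorph_rhmc hU hα t)
    (measurable_rhmc_noise hU α t) f

theorem refreshOp_eq_integral (α : ℝ) (f : Phase → ℝ) (z : Phase) :
    refreshOp α f z = ∫ ξ, f (refresh α z ξ) ∂gaussianReal 0 1 := by
  rw [integral_gaussianReal_eq_integral_smul one_ne_zero, refreshOp, ← integral_const_mul]
  congr 1
  ext ξ
  simp only [gaussianPDFReal, NNReal.coe_one, mul_one, sub_zero, smul_eq_mul, refresh, mul_assoc]

theorem exists_zeroAtInfty_refreshOp {α : ℝ} (hα : α ≠ 0) (f : C₀(Phase, ℝ)) :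
    ∃ g : C₀(Phase, ℝ), ∀ z, g z = refreshOp α f z := by
  simp only [refreshOp_eq_integral]
  exact exists_zeroAtInfty_average (gaussianReal 0 1) (isHomeomorph_refresh hα)
    (fun z => (measurable_refresh α).comp measurable_prodMk_left) f

theorem abs_refreshOp_le {α : ℝ} {f : Phase → ℝ} {C : ℝ} (hC : ∀ z, |f z| ≤ C) (z : Phase) :
    |refreshOp α f z| ≤ C := by
  rw [refreshOp_eq_integral]
  have := norm_integral_le_of_norm_le_const (μ := gaussianReal 0 1)
    (f := fun ξ => f (refresh α z ξ)) (Eventually.of_forall fun w => hC _)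
  simpa using this

theorem abs_le_norm (f : C₀(Phase, ℝ)) (z : Phase) : |f z| ≤ ‖f‖ :=
  f.toBCF.norm_coe_le_norm z

/-- Strong continuity of the flow on `C₀`. -/
theorem IsContinuousFlow.exists_abs_comp_sub_le (hU : IsContinuousFlow U) (f : C₀(Phase, ℝ))
    {ε : ℝ} (hε : 0 < ε) :
    ∃ δ > 0, ∀ r, |r| < δ → ∀ z, |f (hamiltonianFlow U r z) - f z| ≤ ε := by
  obtain ⟨K, hK, hfK⟩ : ∃ K, IsCompact K ∧ ∀ z ∉ K, |f z| < ε / 2 := by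
    have h := f.zero_at_infty'.eventually (Metric.ball_mem_nhds 0 (half_pos hε))
    obtain ⟨K, hK, hKf⟩ := mem_cocompact.1 h
    exact ⟨K, hK, fun z hz => by simpa using hKf hz⟩
  -- A point outside K' cannot reach K within time 1, so both f and its transported value are small
  -- there; on K' compactness gives uniformity.
  set K' := (fun p : ℝ × Phase => hamiltonianFlow U p.1 p.2) '' (Set.Icc (-1) 1 ×ˢ K) with hK'
  have hK'c : IsCompact K' := (isCompact_Icc.prod hK).image hU.continuous
  obtain ⟨v, hv, hvu⟩ := IsCompact.mem_uniformity_of_prod (s := Set.univ) (q := (0 : ℝ)) hK'c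
    (f := fun r z => f (hamiltonianFlow U r z))
    (f.continuous.comp hU.continuous).continuousOn trivial (Metric.dist_mem_uniformity hε)
  rw [nhdsWithin_univ] at hv
  obtain ⟨δ, hδ, hδv⟩ := Metric.mem_nhds_iff.1 hv
  refine ⟨min δ 1, lt_min hδ one_pos, fun r hr z => ?_⟩
  rw [lt_min_iff] at hr
  by_cases hz : z ∈ K'
  · have h := hvu r (hδv (by simpa using hr.1)) z hz
    simp only [Set.mem_ofPred_eq, hU.zero, Real.dist_eq] at h
    exact h.le
  · have h1 : hamiltonianFlow U r z ∉ K := fun h => hz ⟨(-r, hamiltonianFlow U r z),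
      ⟨⟨by linarith [(abs_lt.1 hr.2).2], by linarith [(abs_lt.1 hr.2).1]⟩, h⟩,
      by simp only [← hU.add, add_neg_cancel, hU.zero]⟩
    have h2 : z ∉ K := fun h => hz ⟨(0, z), ⟨by simp, h⟩, hU.zero z⟩
    have := abs_sub (f (hamiltonianFlow U r z)) (f z)
    linarith [hfK _ h1, hfK _ h2]

end Averages

/-! ### Expansion of the transition operators at the first refreshment. -/

section FirstJump

variable {U : ℝ → ℝ} {lam α : ℝ}

/-- The flow between refreshments, as a family of operators. -/
noncomputable def flowTransition (U : ℝ → ℝ) (t : ℝ) (f : Phase → ℝ) (z : Phase) : ℝ :=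
  f (hamiltonianFlow U t z)

theorem stepLaw_real_le (hlam : 0 < lam) {t : ℝ} (ht : 0 ≤ t) :
    (stepLaw lam).real {a | a.1 ≤ t} = 1 - Real.exp (-(lam * t)) := by
  have := isProbabilityMeasure_expMeasure hlam
  have h1 : {a : ℝ × ℝ | a.1 ≤ t} = Set.Iic t ×ˢ Set.univ := by ext; simp
  rw [h1, stepLaw, measureReal_prod_prod, expMeasure_real_Iic hlam ht]
  simp

theorem measurableSet_step_le (t : ℝ) : MeasurableSet {a : ℝ × ℝ | a.1 ≤ t} :=
  measurableSet_le measurable_fst measurable_const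

/-- Decomposition of the transition operators at the first refreshment. -/
theorem transition_first_jump (hlam : 0 < lam) (hU : IsContinuousFlow U) {t : ℝ} (ht : 0 ≤ t)
    {f : Phase → ℝ} (hf : Measurable f) {C : ℝ} (hC : ∀ z, |f z| ≤ C) (z : Phase) :
    ∃ I : ℝ × ℝ → ℝ, Integrable I (stepLaw lam) ∧
      (∀ᵐ a ∂stepLaw lam, a.1 ≤ t → I a = transition (noiseLaw lam) (rhmc U α) (t - a.1) f
        (refresh α (hamiltonianFlow U a.1 z) a.2)) ∧
      transition (noiseLaw lam) (rhmc U α) t f z =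
        Real.exp (-(lam * t)) * f (hamiltonianFlow U t z) +
          ∫ a in {a | a.1 ≤ t}, I a ∂stepLaw lam := by
  have := isProbabilityMeasure_noiseLaw hlam
  have := isProbabilityMeasure_stepLaw hlam
  set μ := noiseLaw lam with hμ
  have hcons : MeasurePreserving (fun p : (ℝ × ℝ) × (ℕ → ℝ × ℝ) => consSeq p.1 p.2)
    ((stepLaw lam).prod μ) μ := measurePreserving_consSeq (stepLaw lam)
  have hFm : Measurable fun w => f (rhmc U α t w z) := hf.comp (measurable_rhmc_noise hU α t z)
  have hint : Integrable (fun p : (ℝ × ℝ) × (ℕ → ℝ × ℝ) => f (rhmc U α t (consSeq p.1 p.2) z))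
      ((stepLaw lam).prod μ) :=
    Integrable.of_bound (hFm.comp hcons.measurable).aestronglyMeasurable C
      (Eventually.of_forall fun p => hC _)
  -- This is the conditional expectation given the first step. Its integrability comes from Fubini,
  -- so joint measurability of the transition operators in time and space is not needed.
  set I : ℝ × ℝ → ℝ := fun a => ∫ w, f (rhmc U α t (consSeq a w) z) ∂μ with hI
  have hIint : Integrable I (stepLaw lam) := hint.integral_prod_left
  have hgood : ∀ᵐ a ∂stepLaw lam, ∀ᵐ w ∂μ, consSeq a w ∈ goodNoise :=
    Measure.ae_ae_of_ae_prod (hcons.quasiMeasurePreserving.ae (ae_mem_goodNoise hlam))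
  refine ⟨I, hIint, ?_, ?_⟩
  · filter_upwards [hgood] with a ha hat
    refine integral_congr_ae ?_
    filter_upwards [ha] with w hw
    have h : rhmc U α t (consSeq a w) z = _ := rhmc_of_le hw hat z
    rw [h]
    rfl
  · have h1 : transition μ (rhmc U α) t f z = ∫ a, I a ∂stepLaw lam := by
      rw [← integral_prod _ hint]
      have h := integral_map (μ := (stepLaw lam).prod μ) hcons.measurable.aemeasurable
        (f := fun w => f (rhmc U α t w z)) hFm.aestronglyMeasurable
      rw [hcons.map_eq] at h
      exact h
    have h2 : ∫ a in {a : ℝ × ℝ | a.1 ≤ t}ᶜ, I a ∂stepLaw lam =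
        ∫ a in {a : ℝ × ℝ | a.1 ≤ t}ᶜ, f (hamiltonianFlow U t z) ∂stepLaw lam := by
      refine setIntegral_congr_ae (measurableSet_step_le t).compl ?_
      filter_upwards [hgood] with a ha hat
      have h3 : I a = ∫ w, f (hamiltonianFlow U t z) ∂μ := by
        refine integral_congr_ae ?_
        filter_upwards [ha] with w hw
        have h : rhmc U α t (consSeq a w) z = _ := rhmc_of_lt hw (not_le.1 hat) z
        rw [h]
      simpa using h3
    rw [h1, ← integral_add_compl (measurableSet_step_le t) hIint, h2, setIntegral_const,
      probReal_compl_eq_one_sub (measurableSet_step_le t), stepLaw_real_le hlam ht, add_comm]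
    simp

theorem abs_transition_sub_flow_le (hlam : 0 < lam) (hU : IsContinuousFlow U) {t : ℝ}
    (ht : 0 ≤ t) {f : Phase → ℝ} (hf : Measurable f) {C : ℝ} (hC : ∀ z, |f z| ≤ C) (z : Phase) :
    |transition (noiseLaw lam) (rhmc U α) t f z - f (hamiltonianFlow U t z)| ≤
      2 * C * (1 - Real.exp (-(lam * t))) := by
  have := isProbabilityMeasure_noiseLaw hlam
  have := isProbabilityMeasure_stepLaw hlam
  obtain ⟨I, -, hI, h⟩ := transition_first_jump (α := α) hlam hU ht hf hC z
  have h1 : |∫ a in {a | a.1 ≤ t}, I a ∂stepLaw lam| ≤ C * (1 - Real.exp (-(lam * t))) := by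
    rw [← stepLaw_real_le hlam ht]
    rw [← Real.norm_eq_abs]
    refine norm_setIntegral_le_of_norm_le_const_ae' (measure_lt_top _ _) ?_
    filter_upwards [hI] with a ha hat
    rw [ha hat]
    exact abs_transition_le hC _ _
  have h2 : Real.exp (-(lam * t)) ≤ 1 := Real.exp_le_one_iff.2 (by nlinarith)
  have h3 : |(1 - Real.exp (-(lam * t))) * f (hamiltonianFlow U t z)| ≤
      C * (1 - Real.exp (-(lam * t))) := by
    rw [abs_mul, abs_of_nonneg (by linarith), mul_comm]
    exact mul_le_mul_of_nonneg_right (hC _) (by linarith)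
  rw [h]
  calc _ = |(∫ a in {a | a.1 ≤ t}, I a ∂stepLaw lam) -
        (1 - Real.exp (-(lam * t))) * f (hamiltonianFlow U t z)| := by congr 1; ring
    _ ≤ _ := (abs_sub _ _).trans (by linarith)

/-- Strong continuity of the transition operators on `C₀`. -/
theorem exists_abs_transition_sub_le (hlam : 0 < lam) (hU : IsContinuousFlow U)
    (f : C₀(Phase, ℝ)) {ε : ℝ} (hε : 0 < ε) :
    ∃ δ > 0, ∀ t, 0 ≤ t → t < δ → ∀ z,
      |transition (noiseLaw lam) (rhmc U α) t f z - f z| ≤ ε := by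
  obtain ⟨δ, hδ, h⟩ := hU.exists_abs_comp_sub_le f (half_pos hε)
  have hlim : Tendsto (fun t : ℝ => 2 * ‖f‖ * (1 - Real.exp (-(lam * t)))) (𝓝 0) (𝓝 0) := by
    have : Continuous fun t : ℝ => 2 * ‖f‖ * (1 - Real.exp (-(lam * t))) := by fun_prop
    simpa using this.tendsto 0
  obtain ⟨δ', hδ', h'⟩ := Metric.eventually_nhds_iff.1 (hlim.eventually (gt_mem_nhds (half_pos hε)))
  refine ⟨min δ δ', lt_min hδ hδ', fun t ht htδ z => ?_⟩
  rw [lt_min_iff] at htδ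
  have h1 := h t (by rw [abs_of_nonneg ht]; exact htδ.1) z
  have h2 := h' (show dist t 0 < δ' by rw [Real.dist_eq, sub_zero, abs_of_nonneg ht]; exact htδ.2)
  have h3 := abs_transition_sub_flow_le (α := α) hlam hU ht (map_continuous f).measurable (abs_le_norm f) z
  have h4 := abs_sub_le (transition (noiseLaw lam) (rhmc U α) t f z) (f (hamiltonianFlow U t z)) (f z)
  linarith

/-- The error is small relative to the probability of a refreshment before t. Half of ε pays for the
evolution after the first refreshment (strong continuity applied to f), half for the flow before it
(strong continuity applied to Q_α f). -/
theorem exists_abs_transition_sub_refreshOp_le (hlam : 0 < lam) (hα : α ≠ 0)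
    (hU : IsContinuousFlow U) (f : C₀(Phase, ℝ)) {ε : ℝ} (hε : 0 < ε) :
    ∃ δ > 0, ∀ t, 0 ≤ t → t < δ → ∀ z,
      |transition (noiseLaw lam) (rhmc U α) t f z -
          Real.exp (-(lam * t)) * f (hamiltonianFlow U t z) -
          (1 - Real.exp (-(lam * t))) * refreshOp α f z| ≤ ε * (1 - Real.exp (-(lam * t))) := by
  have := isProbabilityMeasure_expMeasure hlam
  have := isProbabilityMeasure_noiseLaw hlam
  have := isProbabilityMeasure_stepLaw hlam
  obtain ⟨Qf, hQf⟩ := exists_zeroAtInfty_refreshOp hα f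
  obtain ⟨δ₁, hδ₁, h₁⟩ := exists_abs_transition_sub_le (α := α) hlam hU f (half_pos hε)
  obtain ⟨δ₂, hδ₂, h₂⟩ := hU.exists_abs_comp_sub_le Qf (half_pos hε)
  refine ⟨min δ₁ δ₂, lt_min hδ₁ hδ₂, fun t ht htδ z => ?_⟩
  rw [lt_min_iff] at htδ
  obtain ⟨I, hIint, hI, h⟩ :=
    transition_first_jump (α := α) hlam hU ht (map_continuous f).measurable (abs_le_norm f) z
  set S : Set (ℝ × ℝ) := {a | a.1 ≤ t} with hS
  have hSm : MeasurableSet S := measurableSet_step_le t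
  have hSr : (stepLaw lam).real S = 1 - Real.exp (-(lam * t)) := stepLaw_real_le hlam ht
  set J : ℝ × ℝ → ℝ := fun a => f (refresh α (hamiltonianFlow U a.1 z) a.2) with hJ
  have hflow : Measurable fun a : ℝ × ℝ => hamiltonianFlow U a.1 z :=
    (hU.continuous.comp (by fun_prop : Continuous fun a : ℝ × ℝ => (a.1, z))).measurable
  have hJm : Measurable J := (map_continuous f).measurable.comp
    ((measurable_refresh α).comp (hflow.prodMk measurable_snd))
  have hJint : Integrable J (stepLaw lam) := Integrable.of_bound hJm.aestronglyMeasurable ‖f‖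
    (Eventually.of_forall fun a => abs_le_norm f _)
  have e1 : |(∫ a in S, I a ∂stepLaw lam) - ∫ a in S, J a ∂stepLaw lam| ≤
      ε / 2 * (1 - Real.exp (-(lam * t))) := by
    rw [← integral_sub hIint.integrableOn hJint.integrableOn, ← hSr]
    rw [← Real.norm_eq_abs]
    refine norm_setIntegral_le_of_norm_le_const_ae' (measure_lt_top _ _) ?_
    filter_upwards [hI, ae_stepLaw_pos hlam] with a ha hpos hat
    have hat' : a.1 ≤ t := hat
    rw [ha hat]
    exact h₁ _ (by linarith) (by linarith) _
  have e2 : ∫ a in S, J a ∂stepLaw lam =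
      ∫ r in Set.Iic t, Qf (hamiltonianFlow U r z) ∂expMeasure lam := by
    have hSe : S = Set.Iic t ×ˢ Set.univ := by ext; simp [hS]
    have h1 : (stepLaw lam).restrict S =
        ((expMeasure lam).restrict (Set.Iic t)).prod (gaussianReal 0 1) := by
      rw [hSe, stepLaw, ← Measure.prod_restrict, Measure.restrict_univ]
    have h2 : Integrable J (((expMeasure lam).restrict (Set.Iic t)).prod (gaussianReal 0 1)) := by
      rw [← h1]
      exact hJint.integrableOn
    rw [h1, integral_prod _ h2]
    simp only [hJ, hQf, refreshOp_eq_integral]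
  have hQint : ∀ ν : Measure ℝ, IsFiniteMeasure ν →
      Integrable (fun r => Qf (hamiltonianFlow U r z)) ν := fun ν _ => by
    have : Continuous fun r => Qf (hamiltonianFlow U r z) :=
      Qf.continuous.comp (hU.continuous.comp (Continuous.prodMk_left z))
    exact Integrable.of_bound this.aestronglyMeasurable ‖Qf‖
      (Eventually.of_forall fun r => abs_le_norm Qf _)
  have e3 : |(∫ r in Set.Iic t, Qf (hamiltonianFlow U r z) ∂expMeasure lam) -
      (1 - Real.exp (-(lam * t))) * Qf z| ≤ ε / 2 * (1 - Real.exp (-(lam * t))) := by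
    have h1 : (1 - Real.exp (-(lam * t))) * Qf z = ∫ _ in Set.Iic t, Qf z ∂expMeasure lam := by
      rw [setIntegral_const, expMeasure_real_Iic hlam ht, smul_eq_mul]
    rw [h1, ← integral_sub (hQint _ inferInstance) (integrable_const _),
      ← expMeasure_real_Iic hlam ht]
    rw [← Real.norm_eq_abs]
    refine norm_setIntegral_le_of_norm_le_const_ae' (measure_lt_top _ _) ?_
    filter_upwards [ae_expMeasure_pos hlam] with r hr hrt
    have hrt' : r ≤ t := hrt
    exact h₂ r (by rw [abs_of_pos hr]; linarith) z
  rw [h, ← hQf]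
  rw [e2] at e1
  calc _ = |((∫ a in S, I a ∂stepLaw lam) -
          ∫ r in Set.Iic t, Qf (hamiltonianFlow U r z) ∂expMeasure lam) +
        ((∫ r in Set.Iic t, Qf (hamiltonianFlow U r z) ∂expMeasure lam) -
          (1 - Real.exp (-(lam * t))) * Qf z)| := by congr 1; ring
    _ ≤ _ := (abs_add_le _ _).trans (by linarith)

theorem one_sub_exp_div_tendsto (lam : ℝ) :
    Tendsto (fun t : ℝ => (1 - Real.exp (-(lam * t))) / t) (𝓝[>] 0) (𝓝 lam) := by
  have h : HasDerivAt (fun t : ℝ => 1 - Real.exp (-(lam * t))) lam 0 := by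
    have h1 : HasDerivAt (fun t : ℝ => -(lam * t)) (-(lam * 1)) 0 :=
      ((hasDerivAt_id (0 : ℝ)).const_mul lam).neg
    have h2 := (h1.exp).const_sub 1
    simpa using h2
  have h3 := (hasDerivAt_iff_tendsto_slope.1 h).mono_left
    (nhdsWithin_mono 0 fun x (hx : (0 : ℝ) < x) => hx.ne')
  refine h3.congr fun t => ?_
  simp [slope_def_field]

/-- The difference quotients of the transition operators of the process and of the flow differ by
the bounded operator `lam (Q_α - 1)`, in the limit. -/
theorem tendstoUniformly_quotient_sub (hlam : 0 < lam) (hα : α ≠ 0) (hU : IsContinuousFlow U)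
    (f : C₀(Phase, ℝ)) :
    TendstoUniformly (fun t z => (transition (noiseLaw lam) (rhmc U α) t f z - f z) / t -
        (flowTransition U t f z - f z) / t)
      (fun z => lam * (refreshOp α f z - f z)) (𝓝[>] (0 : ℝ)) := by
  rw [Metric.tendstoUniformly_iff]
  intro ε hε
  have hη : 0 < ε / (4 * lam + 1) := by positivity
  -- Two error terms of size λη must add up to less than ε/2, and 4λη < ε.
  set η := ε / (4 * lam + 1) with hη'
  obtain ⟨δ₁, hδ₁, h₁⟩ := exists_abs_transition_sub_refreshOp_le hlam hα hU f hη
  obtain ⟨δ₂, hδ₂, h₂⟩ := hU.exists_abs_comp_sub_le f hη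
  have hq : 0 < ε / (4 * (‖f‖ + 1)) := by positivity
  have h3 := (Metric.tendsto_nhds.1 (one_sub_exp_div_tendsto lam)) _ hq
  filter_upwards [h3, self_mem_nhdsWithin, Ioo_mem_nhdsGT hδ₁, Ioo_mem_nhdsGT hδ₂]
    with t ht3 ht0 ht1 ht2 z
  have ht0' : (0 : ℝ) < t := ht0
  set p := 1 - Real.exp (-(lam * t)) with hp
  have hpn : 0 ≤ p := by
    have : Real.exp (-(lam * t)) ≤ 1 := Real.exp_le_one_iff.2 (by nlinarith)
    linarith
  have hple : p ≤ lam * t := by linarith [Real.add_one_le_exp (-(lam * t))]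
  have a1 := h₁ t ht0'.le ht1.2 z
  have a2 := h₂ t (by rw [abs_of_pos ht0']; exact ht2.2) z
  have a3 : |refreshOp α f z - f (hamiltonianFlow U t z)| ≤ 2 * ‖f‖ := by
    have := abs_sub (refreshOp α f z) (f (hamiltonianFlow U t z))
    have := abs_refreshOp_le (α := α) (abs_le_norm f) z
    have := abs_le_norm f (hamiltonianFlow U t z)
    linarith
  rw [Real.dist_eq] at ht3 ⊢
  set E := transition (noiseLaw lam) (rhmc U α) t f z -
          Real.exp (-(lam * t)) * f (hamiltonianFlow U t z) - p * refreshOp α f z with hE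
  have hEt : |E / t| ≤ η * lam := by
    rw [abs_div, abs_of_pos ht0', div_le_iff₀ ht0']
    nlinarith
  -- With p the probability of a refreshment before t, Pᵗf - f∘φ_t = p (Q_α f - f∘φ_t) + E; then p/t
  -- is compared with λ and f∘φ_t with f.
  have key : lam * (refreshOp α f z - f z) -
      ((transition (noiseLaw lam) (rhmc U α) t f z - f z) / t - (flowTransition U t f z - f z) / t) =
      -((p / t - lam) * (refreshOp α f z - f (hamiltonianFlow U t z))) +
        (lam * (f (hamiltonianFlow U t z) - f z) - E / t) := by
    have : Real.exp (-(lam * t)) = 1 - p := by rw [hp]; ring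
    simp only [flowTransition, hE, this]
    field_simp
    ring
  rw [key]
  have b1 : |(p / t - lam) * (refreshOp α f z - f (hamiltonianFlow U t z))| ≤ ε / 2 := by
    rw [abs_mul]
    calc _ ≤ ε / (4 * (‖f‖ + 1)) * (2 * ‖f‖) := mul_le_mul ht3.le a3 (abs_nonneg _) hq.le
      _ ≤ ε / (4 * (‖f‖ + 1)) * (2 * (‖f‖ + 1)) := by gcongr; linarith
      _ = ε / 2 := by field_simp; norm_num
  have b2 : |lam * (f (hamiltonianFlow U t z) - f z)| ≤ lam * η := by
    rw [abs_mul, abs_of_pos hlam]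
    gcongr
  have b3 : η * (4 * lam + 1) = ε := by rw [hη']; field_simp
  calc _ ≤ ε / 2 + (lam * η + η * lam) := by
        refine (abs_add_le _ _).trans (add_le_add ?_ ((abs_sub _ _).trans (add_le_add b2 hEt)))
        rwa [abs_neg]
    _ < ε := by nlinarith

end FirstJump

/-! ### Generators of the flow and of the process. -/

section Generators

variable {U : ℝ → ℝ} {lam α : ℝ}

/-- `f` is in the domain of the generator of the Hamiltonian flow, which maps it to `g`, if `g` is
its derivative along the flow. -/
theorem hasGenerator_flow_of_hasDerivAt (hU : IsContinuousFlow U) {f g : C₀(Phase, ℝ)}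
    (h : ∀ z t, HasDerivAt (fun t => f (hamiltonianFlow U t z)) (g (hamiltonianFlow U t z)) t) :
    HasGenerator (flowTransition U) f g := by
  rw [HasGenerator, Metric.tendstoUniformly_iff]
  intro ε hε
  obtain ⟨δ, hδ, hδg⟩ := hU.exists_abs_comp_sub_le g (half_pos hε)
  filter_upwards [self_mem_nhdsWithin, Ioo_mem_nhdsGT hδ] with t ht0 ht z
  have ht0' : (0 : ℝ) < t := ht0
  have h1 := (convex_ball (0 : ℝ) δ).norm_image_sub_le_of_norm_hasDerivWithin_le
    (f := fun r => f (hamiltonianFlow U r z) - r * g z)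
    (f' := fun r => g (hamiltonianFlow U r z) - 1 * g z) (C := ε / 2) (x := 0) (y := t)
    (fun r _ => ((h z r).sub ((hasDerivAt_id r).mul_const (g z))).hasDerivWithinAt)
    (fun r hr => by simpa using hδg r (by simpa using hr) z) (by simpa using hδ)
    (by simpa [abs_of_pos ht0'] using ht.2)
  rw [hU.zero] at h1
  rw [Real.dist_eq, flowTransition]
  have h2 : g z - (f (hamiltonianFlow U t z) - f z) / t =
      -((f (hamiltonianFlow U t z) - t * g z - (f z - 0 * g z)) / t) := by
    field_simp
    ring
  rw [h2, abs_neg, abs_div, abs_of_pos ht0', div_lt_iff₀ ht0']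
  simp only [Real.norm_eq_abs, sub_zero, abs_of_pos ht0'] at h1
  simp only [sub_zero, zero_mul] at h1 ⊢
  nlinarith

/-- A bounded perturbation leaves the domain unchanged, which reduces the core problem to the
deterministic flow. -/
theorem hasGenerator_rhmc_iff (hlam : 0 < lam) (hα : α ≠ 0) (hU : IsContinuousFlow U)
    {f g k : C₀(Phase, ℝ)} (hk : ∀ z, k z = g z + lam * (refreshOp α f z - f z)) :
    HasGenerator (transition (noiseLaw lam) (rhmc U α)) f k ↔
      HasGenerator (flowTransition U) f g := by
  have h := tendstoUniformly_quotient_sub hlam hα hU f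
  constructor
  · intro h1
    have h2 := TendstoUniformly.sub h1 h
    have e1 : (⇑k - fun z => lam * (refreshOp α f z - f z)) = g := by ext z; simp [hk]
    have e2 : ((fun t z => (transition (noiseLaw lam) (rhmc U α) t f z - f z) / t) - fun t z =>
        (transition (noiseLaw lam) (rhmc U α) t f z - f z) / t -
          (flowTransition U t f z - f z) / t) = fun t z => (flowTransition U t f z - f z) / t := by
      ext t z
      simp
    rw [e1, e2] at h2
    exact h2
  · intro h1
    have h2 := TendstoUniformly.add h1 h
    have e1 : (⇑g + fun z => lam * (refreshOp α f z - f z)) = k := by ext z; simp [hk]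
    have e2 : ((fun t z => (flowTransition U t f z - f z) / t) + fun t z =>
        (transition (noiseLaw lam) (rhmc U α) t f z - f z) / t -
          (flowTransition U t f z - f z) / t) =
        fun t z => (transition (noiseLaw lam) (rhmc U α) t f z - f z) / t := by
      ext t z
      simp
    rw [e1, e2] at h2
    exact h2

/-- The derivative of `f` along the Hamiltonian vector field. -/
noncomputable def liouville (U : ℝ → ℝ) (f : Phase → ℝ) (z : Phase) : ℝ :=
  fderiv ℝ f z (hamiltonianField (deriv U) z)

theorem liouville_eq {f : Phase → ℝ} (hf : Differentiable ℝ f) (z : Phase) :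
    liouville U f z =
      deriv (fun x => f (x, z.2)) z.1 * z.2 - deriv (fun v => f (z.1, v)) z.2 * deriv U z.1 := by
  have h1 : HasDerivAt (fun x => f (x, z.2)) (fderiv ℝ f z (1, 0)) z.1 :=
    (hf z).hasFDerivAt.comp_hasDerivAt (f := fun x => (x, z.2)) z.1
      ((hasDerivAt_id z.1).prodMk (hasDerivAt_const z.1 z.2))
  have h2 : HasDerivAt (fun v => f (z.1, v)) (fderiv ℝ f z (0, 1)) z.2 :=
    (hf z).hasFDerivAt.comp_hasDerivAt (f := fun v => (z.1, v)) z.2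
      ((hasDerivAt_const z.2 z.1).prodMk (hasDerivAt_id z.2))
  rw [h1.deriv, h2.deriv, liouville, hamiltonianField]
  have : ((z.2, -deriv U z.1) : Phase) = z.2 • (1, 0) + (-deriv U z.1) • (0, 1) := by simp
  rw [this, map_add, map_smul, map_smul]
  simp only [smul_eq_mul]
  ring

theorem exists_zeroAtInfty_of_hasCompactSupport {f : Phase → ℝ} (hf : Continuous f)
    (h : HasCompactSupport f) : ∃ g : C₀(Phase, ℝ), ⇑g = f :=
  ⟨⟨⟨f, hf⟩, h.is_zero_at_infty⟩, rfl⟩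

theorem exists_hasGenerator_flow (hU0 : ∀ x, 0 ≤ U x) (hU1 : ContDiff ℝ 1 U)
    (hU : IsContinuousFlow U) {f : C₀(Phase, ℝ)} (hf : f ∈ smoothCompact) :
    ∃ g : C₀(Phase, ℝ), (∀ z, g z = liouville U f z) ∧ HasGenerator (flowTransition U) f g := by
  have hUc : Continuous (deriv U) := hU1.continuous_deriv le_rfl
  have hfd : Differentiable ℝ f := hf.1.differentiable (by simp)
  have hc : Continuous (liouville U f) := by
    have h1 : Continuous (fderiv ℝ f) := hf.1.continuous_fderiv (by simp)
    unfold liouville hamiltonianField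
    fun_prop
  have hs : HasCompactSupport (liouville U f) := by
    refine (hf.2.fderiv (𝕜 := ℝ)).mono' fun z hz => ?_
    refine subset_tsupport _ fun h => hz ?_
    simp [liouville, h]
  obtain ⟨g, hg⟩ := exists_zeroAtInfty_of_hasCompactSupport hc hs
  refine ⟨g, fun z => by rw [hg], hasGenerator_flow_of_hasDerivAt hU fun z t => ?_⟩
  rw [hg]
  exact (hfd _).hasFDerivAt.comp_hasDerivAt t ((hamiltonianFlow_spec hU0 hU1 z).1 t)

theorem exists_add_refreshOp (hα : α ≠ 0) (lam : ℝ) (f g : C₀(Phase, ℝ)) :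
    ∃ k : C₀(Phase, ℝ), ∀ z, k z = g z + lam * (refreshOp α f z - f z) := by
  obtain ⟨Qf, hQf⟩ := exists_zeroAtInfty_refreshOp hα f
  exact ⟨g + lam • (Qf - f), fun z => by simp [hQf]⟩

theorem rhmcIsFeller (hlam : 0 < lam) (hα : α ≠ 0) (hU0 : ∀ x, 0 ≤ U x) (hU1 : ContDiff ℝ 1 U)
    (huniq : HamiltonianUniqueness U) : RHMCIsFeller U lam α := by
  have hU := isContinuousFlow_of_uniqueness hU0 hU1 huniq
  refine ⟨hamiltonianFlow_spec hU0 hU1, ⟨fun z => ?_, fun ν _ => isMarkovProcess_rhmc hlam hU α ν,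
    fun t _ f => exists_zeroAtInfty_transition hlam hU hα t f, fun f => ?_⟩, fun f hf => ?_⟩
  · filter_upwards [ae_mem_goodNoise hlam] with w hw
    rw [rhmc_of_lt hw (hw.1 0), hU.zero]
  · rw [Metric.tendstoUniformly_iff]
    intro ε hε
    obtain ⟨δ, hδ, h⟩ := exists_abs_transition_sub_le (α := α) hlam hU f (half_pos hε)
    filter_upwards [Ico_mem_nhdsGE hδ] with t ht z
    rw [dist_comm, Real.dist_eq]
    linarith [h t ht.1 ht.2 z]
  · obtain ⟨g, hg, hgen⟩ := exists_hasGenerator_flow hU0 hU1 hU hf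
    obtain ⟨k, hk⟩ := exists_add_refreshOp hα lam f g
    refine ⟨k, fun z => ?_, (hasGenerator_rhmc_iff hlam hα hU hk).2 hgen⟩
    rw [hk, hg, liouville_eq (hf.1.differentiable (by simp)), rhmcGenerator]

end Generators

/-! ### Smooth approximation by convolution. -/

section Mollification

/-- Regularization of `u` by convolution with a normalized bump function. -/
noncomputable def mollify (φ : ContDiffBump (0 : Phase)) (u : Phase → ℝ) : Phase → ℝ :=
  convolution (φ.normed volume) u (ContinuousLinearMap.lsmul ℝ ℝ) volume

theorem contDiff_mollify (φ : ContDiffBump (0 : Phase)) {u : Phase → ℝ} (hu : Continuous u) :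
    ContDiff ℝ ∞ (mollify φ u) :=
  φ.hasCompactSupport_normed.contDiff_convolution_left _ φ.contDiff_normed hu.locallyIntegrable

theorem hasCompactSupport_mollify (φ : ContDiffBump (0 : Phase)) {u : Phase → ℝ}
    (hs : HasCompactSupport u) : HasCompactSupport (mollify φ u) :=
  φ.hasCompactSupport_normed.convolution _ hs

theorem dist_mollify_le (φ : ContDiffBump (0 : Phase)) {u : Phase → ℝ} (hu : Continuous u)
    {z : Phase} {c ε : ℝ} (hε : 0 ≤ ε) (h : ∀ y ∈ Metric.ball z φ.rOut, dist (u y) c ≤ ε) :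
    dist (mollify φ u z) c ≤ ε :=
  dist_convolution_le hε φ.support_normed_eq.subset φ.nonneg_normed φ.integral_normed
    hu.aestronglyMeasurable h

/-- Convolution commutes with translation by y - z. With y = φ_t(z), the difference quotient along
the flow becomes an average of quotients of u under a rigid translation. -/
theorem mollify_quotient (φ : ContDiffBump (0 : Phase)) {u : Phase → ℝ} (hu : Continuous u)
    (y z : Phase) (t : ℝ) :
    (mollify φ u y - mollify φ u z) / t = mollify φ (fun x => (u (y - z + x) - u x) / t) z := by
  have hi : ∀ p : Phase, Integrable fun s => φ.normed volume s * u (p - s) := fun p =>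
    ((φ.continuous_normed (μ := volume)).mul (hu.comp (by fun_prop))).integrable_of_hasCompactSupport
      (φ.hasCompactSupport_normed.mul_right)
  simp only [mollify, convolution_def, ContinuousLinearMap.lsmul_apply, smul_eq_mul]
  rw [← integral_sub (hi y) (hi z), ← integral_div]
  congr 1
  ext s
  rw [show y - z + (z - s) = y - s by abel]
  ring

/-- A bump function with small support. -/
theorem exists_contDiffBump {η : ℝ} (hη : 0 < η) : ∃ φ : ContDiffBump (0 : Phase), φ.rOut = η :=
  ⟨⟨η / 2, η, half_pos hη, half_lt_self hη⟩, rfl⟩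

theorem norm_le_of_forall_abs_le {f : C₀(Phase, ℝ)} {C : ℝ} (hC : 0 ≤ C) (h : ∀ z, |f z| ≤ C) :
    ‖f‖ ≤ C :=
  (BoundedContinuousFunction.norm_le hC (f := f.toBCF)).2 h

/-- Smooth functions with compact support are dense in `C₀`. -/
theorem exists_smoothCompact_norm_sub_le (f : C₀(Phase, ℝ)) {ε : ℝ} (hε : 0 < ε) :
    ∃ f' ∈ smoothCompact, ‖f' - f‖ ≤ ε := by
  obtain ⟨R, hR, hfR⟩ : ∃ R > 0, ∀ z, R ≤ ‖z‖ → |f z| < ε / 2 := by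
    have h := f.zero_at_infty'.eventually (Metric.ball_mem_nhds 0 (half_pos hε))
    rw [← Metric.cobounded_eq_cocompact, ← comap_norm_atTop, eventually_comap] at h
    obtain ⟨R, hR⟩ := eventually_atTop.1 h
    exact ⟨max R 1, lt_max_of_lt_right one_pos, fun z hz => by
      simpa using hR ‖z‖ ((le_max_left _ _).trans hz) z rfl⟩
  let χ : ContDiffBump (0 : Phase) := ⟨R, R + 1, hR, lt_add_one R⟩
  set u : Phase → ℝ := fun z => χ z * f z with hu
  have huc : Continuous u := χ.continuous.mul (map_continuous f)
  have hus : HasCompactSupport u := χ.hasCompactSupport.mul_right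
  have huf : ∀ z, |u z - f z| ≤ ε / 2 := by
    intro z
    rcases le_total R ‖z‖ with h | h
    · have h1 : u z - f z = -((1 - χ z) * f z) := by simp only [hu]; ring
      rw [h1, abs_neg, abs_mul, abs_of_nonneg (sub_nonneg.2 χ.le_one)]
      have h2 := hfR z h
      have h3 := χ.nonneg (x := z)
      nlinarith [abs_nonneg (f z)]
    · have : χ z = 1 := χ.one_of_mem_closedBall (by simpa using h)
      simp only [hu, this, one_mul, sub_self, abs_zero]
      positivity
  obtain ⟨η, hη, h⟩ := Metric.uniformContinuous_iff.1
    (huc.uniformContinuous_of_tendsto_cocompact hus.is_zero_at_infty) (ε / 2) (half_pos hε)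
  obtain ⟨φ, hφ⟩ := exists_contDiffBump hη
  obtain ⟨f', hf'⟩ := exists_zeroAtInfty_of_hasCompactSupport (contDiff_mollify φ huc).continuous
    (hasCompactSupport_mollify φ hus)
  refine ⟨f', ⟨by rw [hf']; exact contDiff_mollify φ huc,
    by rw [hf']; exact hasCompactSupport_mollify φ hus⟩, norm_le_of_forall_abs_le hε.le fun z => ?_⟩
  have h1 := dist_mollify_le φ huc (z := z) (c := u z) (half_pos hε).le
    (fun y hy => (h (by rwa [hφ] at hy)).le)
  rw [Real.dist_eq] at h1
  have h2 := abs_sub_le (mollify φ u z) (u z) (f z)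
  simp only [ZeroAtInftyContinuousMap.coe_sub, Pi.sub_apply, hf']
  linarith [huf z]

end Mollification

/-! ### The core property. -/

section Core

variable {U : ℝ → ℝ} {K : NNReal}

theorem dist_hamiltonianFlow_le (hU0 : ∀ x, 0 ≤ U x) (hU1 : ContDiff ℝ 1 U)
    (hK : LipschitzWith K (deriv U)) {t : ℝ} (ht : 0 ≤ t) (y z : Phase) :
    dist (hamiltonianFlow U t y) (hamiltonianFlow U t z) ≤
      dist y z * Real.exp ((max 1 K : NNReal) * t) := by
  have h := fun z => (hamiltonianFlow_spec hU0 hU1 z).1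
  have hc : ∀ z, ContinuousOn (fun t => hamiltonianFlow U t z) (Set.Icc 0 t) := fun z =>
    (continuous_iff_continuousAt.2 fun s => (h z s).continuousAt).continuousOn
  have := dist_le_of_trajectories_ODE (v := fun _ => hamiltonianField (deriv U)) (a := 0) (b := t)
    (δ := dist y z) (fun _ => lipschitzWith_hamiltonianField hK) (hc y)
    (fun s _ => (h y s).hasDerivWithinAt) (hc z) (fun s _ => (h z s).hasDerivWithinAt)
    (by simp only [hamiltonianFlow_zero hU0 hU1, le_refl]) t ⟨ht, le_rfl⟩
  simpa using this

/-- For short times, the displacements of two points under the flow differ little. -/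
theorem norm_displacement_sub_le (hU0 : ∀ x, 0 ≤ U x) (hU1 : ContDiff ℝ 1 U)
    (hK : LipschitzWith K (deriv U)) :
    ∃ D : ℝ, 0 ≤ D ∧ ∀ t, 0 ≤ t → t ≤ 1 → ∀ y z,
      ‖(hamiltonianFlow U t y - y) - (hamiltonianFlow U t z - z)‖ ≤ D * ‖y - z‖ * t := by
  set L : NNReal := max 1 K with hL
  refine ⟨L * Real.exp L, by positivity, fun t ht ht1 y z => ?_⟩
  have h := fun z => (hamiltonianFlow_spec hU0 hU1 z).1
  have h1 := norm_image_sub_le_of_norm_deriv_le_segment' (a := 0) (b := t)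
    (f := fun s => hamiltonianFlow U s y - hamiltonianFlow U s z)
    (f' := fun s => hamiltonianField (deriv U) (hamiltonianFlow U s y) -
      hamiltonianField (deriv U) (hamiltonianFlow U s z)) (C := L * Real.exp L * ‖y - z‖)
    (fun s _ => ((h y s).sub (h z s)).hasDerivWithinAt) (fun s hs => ?_) t ⟨ht, le_rfl⟩
  · simp only [hamiltonianFlow_zero hU0 hU1, sub_zero] at h1
    rwa [sub_sub_sub_comm]
  · rw [← dist_eq_norm]
    refine ((lipschitzWith_hamiltonianField hK).dist_le_mul _ _).trans ?_
    rw [← hL, mul_assoc]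
    gcongr
    refine (dist_hamiltonianFlow_le hU0 hU1 hK hs.1 y z).trans ?_
    rw [mul_comm, dist_eq_norm]
    gcongr
    exact mul_le_of_le_one_right (by positivity) (hs.2.le.trans ht1)

/-- A Lipschitz function with compact support which is differentiable along the flow can be
approximated by smooth ones, together with its derivative along the flow. -/
theorem exists_smooth_approx (hU0 : ∀ x, 0 ≤ U x) (hU1 : ContDiff ℝ 1 U)
    (hU : IsContinuousFlow U) (hK : LipschitzWith K (deriv U)) {u h : C₀(Phase, ℝ)}
    (hus : HasCompactSupport u) {C : NNReal} (huC : LipschitzWith C u)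
    (hgen : HasGenerator (flowTransition U) u h) {ε : ℝ} (hε : 0 < ε) :
    ∃ f' ∈ smoothCompact, ∃ g' : C₀(Phase, ℝ), HasGenerator (flowTransition U) f' g' ∧
      ‖f' - u‖ ≤ ε ∧ ‖g' - h‖ ≤ ε := by
  have huc : Continuous u := map_continuous u
  have hhu : UniformContinuous h := ZeroAtInftyContinuousMap.uniformContinuous h
  obtain ⟨D, hD0, hD⟩ := norm_displacement_sub_le hU0 hU1 hK
  obtain ⟨η₁, hη₁, h₁⟩ := Metric.uniformContinuous_iff.1 hhu (ε / 4) (by positivity)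
  obtain ⟨η₂, hη₂, h₂⟩ := Metric.uniformContinuous_iff.1 huC.uniformContinuous ε hε
  -- η₁ is for the continuity of h, η₂ for that of u, and the last term keeps the commutator error C
  -- D η below ε/4.
  set η := min (min η₁ η₂) (ε / (4 * (C * D + 1))) with hη
  have hηpos : 0 < η := lt_min (lt_min hη₁ hη₂) (by positivity)
  obtain ⟨φ, hφ⟩ := exists_contDiffBump hηpos
  have hsm : ContDiff ℝ ∞ (mollify φ u) := contDiff_mollify φ huc
  obtain ⟨f', hf'⟩ := exists_zeroAtInfty_of_hasCompactSupport hsm.continuous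
    (hasCompactSupport_mollify φ hus)
  have hf'mem : f' ∈ smoothCompact := ⟨by rw [hf']; exact hsm,
    by rw [hf']; exact hasCompactSupport_mollify φ hus⟩
  obtain ⟨g', -, hg'⟩ := exists_hasGenerator_flow hU0 hU1 hU hf'mem
  refine ⟨f', hf'mem, g', hg', norm_le_of_forall_abs_le hε.le fun z => ?_,
    norm_le_of_forall_abs_le hε.le fun z => ?_⟩
  · have := dist_mollify_le φ huc (z := z) (c := u z) hε.le fun y hy => (h₂ (by
      rw [hφ] at hy
      exact lt_of_lt_of_le hy ((min_le_left _ _).trans (min_le_right _ _)))).le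
    simpa only [ZeroAtInftyContinuousMap.coe_sub, Pi.sub_apply, hf', Real.dist_eq] using this
  · have hlim : Tendsto (fun t => dist ((flowTransition U t f' z - f' z) / t) (h z)) (𝓝[>] 0)
        (𝓝 (dist (g' z) (h z))) := (TendstoUniformly.tendsto_at hg' z).dist tendsto_const_nhds
    simp only [ZeroAtInftyContinuousMap.coe_sub, Pi.sub_apply]
    rw [← Real.dist_eq]
    refine le_of_tendsto hlim ?_
    filter_upwards [Metric.tendstoUniformly_iff.1 hgen (ε / 4) (by positivity),
      self_mem_nhdsWithin, Ioo_mem_nhdsGT one_pos] with t ht ht0 ht1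
    have ht0' : (0 : ℝ) < t := ht0
    rw [flowTransition, hf', mollify_quotient φ huc]
    refine dist_mollify_le φ (by fun_prop) hε.le fun x hx => ?_
    rw [hφ, Metric.mem_ball] at hx
    -- The commutator: translating x by the displacement of z instead of letting x flow costs at
    -- most C D ‖z - x‖ t. Division by t leaves a bound independent of t.
    have a1 : |(u (hamiltonianFlow U t z - z + x) - u (hamiltonianFlow U t x)) / t| ≤ ε / 4 := by
      rw [abs_div, abs_of_pos ht0', div_le_iff₀ ht0']
      have b1 := huC.dist_le_mul (hamiltonianFlow U t z - z + x) (hamiltonianFlow U t x)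
      have b2 := hD t ht0'.le ht1.2.le z x
      rw [Real.dist_eq, dist_eq_norm, show hamiltonianFlow U t z - z + x - hamiltonianFlow U t x =
        (hamiltonianFlow U t z - z) - (hamiltonianFlow U t x - x) by abel] at b1
      have b3 : ‖z - x‖ ≤ ε / (4 * (C * D + 1)) := by
        rw [← dist_eq_norm, dist_comm]
        exact hx.le.trans (min_le_right _ _)
      have b4 : (C * D) * (ε / (4 * (C * D + 1))) ≤ ε / 4 := by
        rw [mul_div_assoc', div_le_div_iff₀ (by positivity) (by positivity)]
        nlinarith
      calc _ ≤ C * (D * ‖z - x‖ * t) := b1.trans (by gcongr)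
        _ = (C * D) * ‖z - x‖ * t := by ring
        _ ≤ (C * D) * (ε / (4 * (C * D + 1))) * t := by gcongr
        _ ≤ ε / 4 * t := by gcongr
    have a2 := ht x
    rw [dist_comm, Real.dist_eq, flowTransition] at a2
    have a3 : |h x - h z| < ε / 4 := by
      rw [← Real.dist_eq]
      exact h₁ (lt_of_lt_of_le hx ((min_le_left _ _).trans (min_le_left _ _)))
    rw [Real.dist_eq]
    calc _ = |(u (hamiltonianFlow U t z - z + x) - u (hamiltonianFlow U t x)) / t +
          ((u (hamiltonianFlow U t x) - u x) / t - h x) + (h x - h z)| := by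
          congr 1
          ring
      _ ≤ ε := (abs_add_three _ _ _).trans (by linarith)

theorem hasCompactSupport_comp_flow (hU : IsContinuousFlow U) {f : Phase → ℝ}
    (hf : HasCompactSupport f) (t : ℝ) : HasCompactSupport fun z => f (hamiltonianFlow U t z) :=
  hf.comp_isClosedEmbedding (hU.isHomeomorph t).isClosedEmbedding

/-- Approximate resolvent of the flow, at `1`. -/
theorem exists_approx_resolvent (hU0 : ∀ x, 0 ≤ U x) (hU1 : ContDiff ℝ 1 U)
    (hU : IsContinuousFlow U) (hK : LipschitzWith K (deriv U)) {f : C₀(Phase, ℝ)}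
    (hf : f ∈ smoothCompact) {ε : ℝ} (hε : 0 < ε) :
    ∃ u h : C₀(Phase, ℝ), HasCompactSupport u ∧ (∃ C, LipschitzWith C u) ∧
      HasGenerator (flowTransition U) u h ∧ ‖u - h - f‖ ≤ ε := by
  obtain ⟨T, hT0, hT⟩ : ∃ T : ℝ, 0 ≤ T ∧ Real.exp (-T) * ‖f‖ ≤ ε := by
    have : Tendsto (fun T : ℝ => Real.exp (-T) * ‖f‖) atTop (𝓝 0) := by
      simpa using (Real.tendsto_exp_neg_atTop_nhds_zero).mul_const ‖f‖
    obtain ⟨T, h1, h2⟩ := ((eventually_ge_atTop 0).and (this.eventually (gt_mem_nhds hε))).exists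
    exact ⟨T, h1, h2.le⟩
  set L : NNReal := max 1 K with hL
  obtain ⟨C, hC⟩ := ContDiff.lipschitzWith_of_hasCompactSupport hf.2 hf.1 (by simp)
  have hfc : Continuous f := map_continuous f
  set F : Phase → ℝ → ℝ := fun z t => Real.exp (-t) * f (hamiltonianFlow U t z) with hF
  have hFc : ∀ z, Continuous (F z) := fun z => by
    have : Continuous fun t => hamiltonianFlow U t z := hU.continuous.comp (Continuous.prodMk_left z)
    fun_prop
  set u : Phase → ℝ := fun z => ∫ t in (0 : ℝ)..T, F z t with hu
  -- Truncation at T matters: the Lipschitz bound of f∘φ_t grows like e^(Lt) with L ≥ 1, which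
  -- e^(-t) does not compensate. It also keeps the support compact.
  have hulip : LipschitzWith (Real.toNNReal (C * Real.exp (L * T) * T)) u := by
    refine LipschitzWith.of_dist_le_mul fun y z => ?_
    rw [Real.coe_toNNReal _ (by positivity), Real.dist_eq, ← intervalIntegral.integral_sub
      ((hFc y).intervalIntegrable _ _) ((hFc z).intervalIntegrable _ _)]
    have h1 := intervalIntegral.norm_integral_le_of_norm_le_const (a := 0) (b := T)
      (f := fun t => F y t - F z t) (C := C * Real.exp (L * T) * dist y z) fun t ht => ?_
    · rw [sub_zero, abs_of_nonneg hT0] at h1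
      refine h1.trans (le_of_eq (by ring))
    · rw [Set.uIoc_of_le hT0] at ht
      have h2 := (hC.dist_le_mul (hamiltonianFlow U t y) (hamiltonianFlow U t z)).trans
        (mul_le_mul_of_nonneg_left (dist_hamiltonianFlow_le hU0 hU1 hK ht.1.le y z) C.coe_nonneg)
      have h3 : Real.exp (-t) ≤ 1 := Real.exp_le_one_iff.2 (by linarith [ht.1])
      have h4 : Real.exp (L * t) ≤ Real.exp (L * T) := Real.exp_le_exp.2 (by gcongr; exact ht.2)
      rw [Real.dist_eq] at h2
      simp only [hF, ← mul_sub, Real.norm_eq_abs, abs_mul, abs_of_pos (Real.exp_pos _)]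
      calc _ ≤ 1 * (C * (dist y z * Real.exp (L * t))) :=
            mul_le_mul h3 h2 (abs_nonneg _) zero_le_one
        _ ≤ 1 * (C * (dist y z * Real.exp (L * T))) := by gcongr
        _ = _ := by ring
  have huc : Continuous u := hulip.continuous
  have hus : HasCompactSupport u := by
    have hKc : IsCompact ((fun p : ℝ × Phase => hamiltonianFlow U (-p.1) p.2) ''
        (Set.Icc 0 T ×ˢ tsupport f)) :=
      (isCompact_Icc.prod hf.2).image (hU.continuous.comp
        (by fun_prop : Continuous fun p : ℝ × Phase => (-p.1, p.2)))
    refine HasCompactSupport.intro hKc fun z hz => ?_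
    refine intervalIntegral.integral_zero_ae (Eventually.of_forall fun t ht => ?_)
    rw [Set.uIoc_of_le hT0] at ht
    have : f (hamiltonianFlow U t z) = 0 := by
      by_contra hne
      exact hz ⟨(t, hamiltonianFlow U t z), ⟨⟨ht.1.le, ht.2⟩, subset_tsupport _ hne⟩,
        by simp only [← hU.add, add_neg_cancel, hU.zero]⟩
    simp only [hF, this, mul_zero]
  set h : Phase → ℝ := fun z => u z - f z + Real.exp (-T) * f (hamiltonianFlow U T z) with hh
  have hhc : Continuous h := by
    have := hU.continuous_time T
    fun_prop
  have hhs : HasCompactSupport h := (hus.sub hf.2).add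
    ((hasCompactSupport_comp_flow hU hf.2 T).mul_left (f := fun _ => Real.exp (-T)))
  have hder : ∀ z s, HasDerivAt (fun s => u (hamiltonianFlow U s z))
      (h (hamiltonianFlow U s z)) s := by
    intro z s
    -- By the group property, u(φ_s z) is eˢ times the integral of `F z` over the moving window [s,
    -- s + T], so its derivative comes from the two end points and from eˢ.
    have e1 : ∀ s, u (hamiltonianFlow U s z) =
        Real.exp s * ((∫ r in (0 : ℝ)..(s + T), F z r) - ∫ r in (0 : ℝ)..s, F z r) := by
      intro s
      have h1 : ∀ t, F (hamiltonianFlow U s z) t = Real.exp s * F z (s + t) := by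
        intro t
        simp only [hF, ← hU.add, ← mul_assoc, ← Real.exp_add]
        congr 2
        ring
      simp only [hu, h1]
      rw [intervalIntegral.integral_const_mul, intervalIntegral.integral_comp_add_left (F z),
        add_zero, intervalIntegral.integral_interval_sub_left] <;>
        exact (hFc z).intervalIntegrable _ _
    have hG : ∀ y, HasDerivAt (fun y => ∫ r in (0 : ℝ)..y, F z r) (F z y) y := fun y =>
      intervalIntegral.integral_hasDerivAt_right ((hFc z).intervalIntegrable _ _)
        ((hFc z).stronglyMeasurableAtFilter _ _) (hFc z).continuousAt
    have h2 := (Real.hasDerivAt_exp s).mul (((hG (s + T)).comp_add_const s T).sub (hG s))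
    refine (h2.congr_of_eventuallyEq (Eventually.of_forall e1)).congr_deriv ?_
    simp only [hh, e1, hF, Pi.sub_apply, ← hU.add]
    have h3 : Real.exp s * Real.exp (-(s + T)) = Real.exp (-T) := by
      rw [← Real.exp_add]
      ring_nf
    have h4 : Real.exp s * Real.exp (-s) = 1 := by
      rw [← Real.exp_add, add_neg_cancel, Real.exp_zero]
    rw [mul_sub (Real.exp s) (_ * _), ← mul_assoc, ← mul_assoc, h3, h4]
    ring
  obtain ⟨u', hu'⟩ := exists_zeroAtInfty_of_hasCompactSupport huc hus
  obtain ⟨h', hh'⟩ := exists_zeroAtInfty_of_hasCompactSupport hhc hhs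
  refine ⟨u', h', by rwa [hu'], ⟨_, by rw [hu']; exact hulip⟩,
    hasGenerator_flow_of_hasDerivAt hU (by rw [hu', hh']; exact hder),
    norm_le_of_forall_abs_le hε.le fun z => ?_⟩
  have e : (u' - h' - f) z = -(Real.exp (-T) * f (hamiltonianFlow U T z)) := by
    simp only [ZeroAtInftyContinuousMap.coe_sub, Pi.sub_apply, hu', hh', hh]
    ring
  rw [e, abs_neg, abs_mul, abs_of_pos (Real.exp_pos _)]
  exact (mul_le_mul_of_nonneg_left (abs_le_norm f _) (Real.exp_pos _).le).trans hT

theorem HasGenerator.flow_sub {f g f' g' : C₀(Phase, ℝ)}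
    (h : HasGenerator (flowTransition U) f g) (h' : HasGenerator (flowTransition U) f' g') :
    HasGenerator (flowTransition U) (f - f') (g - g') := by
  have h2 := TendstoUniformly.sub h h'
  have e : ((fun t z => (flowTransition U t f z - f z) / t) - fun t z =>
      (flowTransition U t f' z - f' z) / t) =
      fun t z => (flowTransition U t (f - f' : C₀(Phase, ℝ)) z - (f - f') z) / t := by
    ext t z
    simp only [Pi.sub_apply, flowTransition, ZeroAtInftyContinuousMap.coe_sub]
    ring
  rw [e] at h2
  exact h2

/-- The generator of the flow is dissipative. -/
theorem HasGenerator.norm_le_norm_sub {u k : C₀(Phase, ℝ)}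
    (h : HasGenerator (flowTransition U) u k) : ‖u‖ ≤ ‖u - k‖ := by
  refine le_of_forall_pos_le_add fun ε hε => ?_
  obtain ⟨t, ht, ht0⟩ := ((Metric.tendstoUniformly_iff.1 h ε hε).and self_mem_nhdsWithin).exists
  have ht0' : (0 : ℝ) < t := ht0
  have key : (1 + t) * ‖u‖ ≤ ‖u‖ + t * (‖u - k‖ + ε) := by
    have h1 : ‖(1 + t) • u‖ ≤ ‖u‖ + t * (‖u - k‖ + ε) := by
      refine norm_le_of_forall_abs_le (by positivity) fun z => ?_
      have a1 := ht z
      have a2 := abs_le_norm (u - k) z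
      have a3 := abs_le_norm u (hamiltonianFlow U t z)
      rw [Real.dist_eq] at a1
      simp only [flowTransition] at a1
      -- Since the flow is a contraction for the sup norm, (1 + t)u is a function of norm at most
      -- ‖u‖ plus t times (u - k), up to the error of the difference quotient.
      have e : ((1 + t) • u) z = u (hamiltonianFlow U t z) + t * ((u - k) z +
          (k z - (u (hamiltonianFlow U t z) - u z) / t)) := by
        simp only [ZeroAtInftyContinuousMap.coe_smul, ZeroAtInftyContinuousMap.coe_sub,
          Pi.smul_apply, Pi.sub_apply, smul_eq_mul]
        field_simp
        ring
      rw [e]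
      refine (abs_add_le _ _).trans (add_le_add a3 ?_)
      rw [abs_mul, abs_of_pos ht0']
      exact mul_le_mul_of_nonneg_left ((abs_add_le _ _).trans (add_le_add a2 a1.le)) ht0'.le
    rwa [norm_smul, Real.norm_eq_abs, abs_of_pos (by linarith)] at h1
  have : t * ‖u‖ ≤ t * (‖u - k‖ + ε) := by linarith
  exact le_of_mul_le_mul_left this ht0'

/-- With A the generator of the flow, it is enough to approximate f - g = (1 - A)f by (1 - A)f' with
f' smooth: dissipativity then controls f' - f, and g' - g follows by subtraction. -/
theorem exists_core_approx_flow (hU0 : ∀ x, 0 ≤ U x) (hU1 : ContDiff ℝ 1 U)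
    (hU : IsContinuousFlow U) (hK : LipschitzWith K (deriv U)) {f g : C₀(Phase, ℝ)}
    (hfg : HasGenerator (flowTransition U) f g) {ε : ℝ} (hε : 0 < ε) :
    ∃ f' ∈ smoothCompact, ∃ g' : C₀(Phase, ℝ), HasGenerator (flowTransition U) f' g' ∧
      ‖f' - f‖ ≤ ε ∧ ‖g' - g‖ ≤ ε := by
  -- Four errors of size ε/8 enter, from the density in C₀, the truncated resolvent, and the
  -- mollification of u and of its image. Their sum ε/2 is counted twice for g' - g.
  have hδ : 0 < ε / 8 := by positivity
  obtain ⟨f₀, hf₀, h₀⟩ := exists_smoothCompact_norm_sub_le (f - g) hδ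
  obtain ⟨u, h, hus, ⟨C, hC⟩, hgen, huh⟩ := exists_approx_resolvent hU0 hU1 hU hK hf₀ hδ
  obtain ⟨f', hf', g', hg', h1, h2⟩ := exists_smooth_approx hU0 hU1 hU hK hus hC hgen hδ
  have e : (f' - f) - (g' - g) = (f' - u) - (g' - h) + (u - h - f₀) + (f₀ - (f - g)) := by abel
  have hn : ‖(f' - f) - (g' - g)‖ ≤ ε / 2 := by
    rw [e]
    have a1 := norm_add_le ((f' - u) - (g' - h) + (u - h - f₀)) (f₀ - (f - g))
    have a2 := norm_add_le ((f' - u) - (g' - h)) (u - h - f₀)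
    have a3 := norm_sub_le (f' - u) (g' - h)
    linarith
  have hn1 : ‖f' - f‖ ≤ ε / 2 := (hg'.flow_sub hfg).norm_le_norm_sub.trans hn
  refine ⟨f', hf', g', hg', by linarith, ?_⟩
  have a4 := norm_sub_le (f' - f) ((f' - f) - (g' - g))
  rw [sub_sub_cancel] at a4
  linarith

theorem refreshOp_sub (α : ℝ) (f f' : C₀(Phase, ℝ)) (z : Phase) :
    refreshOp α f z - refreshOp α f' z = refreshOp α (f - f' : C₀(Phase, ℝ)) z := by
  have hi : ∀ f : C₀(Phase, ℝ), Integrable (fun ξ => f (refresh α z ξ)) (gaussianReal 0 1) :=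
    fun f => Integrable.of_bound ((map_continuous f).measurable.comp
      ((measurable_refresh α).comp measurable_prodMk_left)).aestronglyMeasurable ‖f‖
      (Eventually.of_forall fun _ => abs_le_norm f _)
  simp only [refreshOp_eq_integral]
  rw [← integral_sub (hi f) (hi f')]
  rfl

theorem isCore_smoothCompact {lam α : ℝ} (hlam : 0 < lam) (hα : α ≠ 0) (hU0 : ∀ x, 0 ≤ U x)
    (hU1 : ContDiff ℝ 1 U) (hK : LipschitzWith K (deriv U)) :
    IsCore (transition (noiseLaw lam) (rhmc U α)) smoothCompact := by
  have hU := isContinuousFlow_of_uniqueness hU0 hU1 (hamiltonianUniqueness_of_lipschitzWith hK)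
  refine ⟨fun f hf => ?_, fun f g hfg ε hε => ?_⟩
  · obtain ⟨g, -, hg⟩ := exists_hasGenerator_flow hU0 hU1 hU hf
    obtain ⟨k, hk⟩ := exists_add_refreshOp hα lam f g
    exact ⟨k, (hasGenerator_rhmc_iff hlam hα hU hk).2 hg⟩
  -- Rate -λ removes the refreshment term from g, leaving the image of f under the generator of the
  -- flow.
  · obtain ⟨g₀, hg₀⟩ := exists_add_refreshOp hα (-lam) f g
    have hflow : HasGenerator (flowTransition U) f g₀ :=
      (hasGenerator_rhmc_iff hlam hα hU fun z => by rw [hg₀]; ring).1 hfg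
    -- The graph norm error is at most η + (η + 2λη) = 2(1 + λ)η = ε/2.
    have hη : 0 < ε / (4 * (1 + lam)) := by positivity
    set η := ε / (4 * (1 + lam)) with hη'
    obtain ⟨f', hf', g₁, hg₁, h1, h2⟩ := exists_core_approx_flow hU0 hU1 hU hK hflow hη
    obtain ⟨g', hg'⟩ := exists_add_refreshOp hα lam f' g₁
    refine ⟨f', hf', g', (hasGenerator_rhmc_iff hlam hα hU hg').2 hg₁, ?_⟩
    have h3 : ‖g' - g‖ ≤ η + lam * (η + η) := by
      refine norm_le_of_forall_abs_le (by positivity) fun z => ?_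
      have e : (g' - g) z = (g₁ - g₀) z + lam *
          (refreshOp α (f' - f : C₀(Phase, ℝ)) z - (f' - f) z) := by
        rw [← refreshOp_sub]
        simp only [ZeroAtInftyContinuousMap.coe_sub, Pi.sub_apply, hg', hg₀]
        ring
      have b1 := (abs_le_norm (g₁ - g₀) z).trans h2
      have b2 := (abs_refreshOp_le (α := α) (abs_le_norm (f' - f)) z).trans h1
      have b3 := (abs_le_norm (f' - f) z).trans h1
      rw [e]
      refine (abs_add_le _ _).trans (add_le_add b1 ?_)
      rw [abs_mul, abs_of_pos hlam]
      exact mul_le_mul_of_nonneg_left ((abs_sub _ _).trans (add_le_add b2 b3)) hlam.le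
    have h4 : η * (4 * (1 + lam)) = ε := by rw [hη']; field_simp
    nlinarith

end Core

theorem mainTheorem6 (U : ℝ → ℝ) (lam α : ℝ) (hlam : 0 < lam) (hα0 : 0 < α) (hα1 : α < 1)
    (hU0 : ∀ x, 0 ≤ U x) (hU1 : ContDiff ℝ 1 U) :
    (HamiltonianUniqueness U → RHMCIsFeller U lam α) ∧
    (ContDiff ℝ ∞ U → (∃ M : ℝ, ∀ x, |iteratedDeriv 2 U x| ≤ M) →
      RHMCIsFeller U lam α ∧
        IsCore (transition (noiseLaw lam) (rhmc U α)) smoothCompact) := by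
  refine ⟨rhmcIsFeller hlam hα0.ne' hU0 hU1, fun hU hM => ?_⟩
  obtain ⟨K, hK⟩ := exists_lipschitzWith_deriv hU hM
  exact ⟨rhmcIsFeller hlam hα0.ne' hU0 hU1 (hamiltonianUniqueness_of_lipschitzWith hK),
    isCore_smoothCompact hlam hα0.ne' hU0 hU1 hK⟩
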